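/- Let $k,n\in\mathbb N$ with $n>2k\ge 2$, and let $\Delta_\xi=-\sum_{i=1}^n\partial_i^2$ be the Euclidean Laplacian with the geometers' sign convention. There exists a function $\Gamma\in L^1(\mathbb R^n)$, unique in $L^1(\mathbb{R}^n)$ (that is, up to equality almost everywhere), such that $$\varphi(0)=\int_{\mathbb R^n}\Gamma(x)\,\bigl(\Delta_\xi^k\varphi+\varphi\bigr)(x)\,dx\qquad\text{for all }\varphi\in C_c^\infty(\mathbb R^n).$$ Moreover, after modification on a null set, $\Gamma$ has the following properties. 1. $\Gamma\in C^\infty(\mathbb R^n\setminus\{0\})$, and $\Gamma$ is radially symmetric. 2. With $\mathrm{Ga}$ denoting the Gamma function, $$\lim_{x\to0,\ x\neq 0}|x|^{n-2k}\,\Gamma(x)=\frac{\mathrm{Ga}\left(\frac n2-k\right)}{2^{2k}\,(k-1)!\,\pi^{n/2}}.$$ 3. For all $l,q\in\mathbb N=\{0,1,2,\dots\}$ there exists a constant $C_{q,l,n,k}>0$, depending only on $q,l,n,k$, such that $$|\nabla^l\Gamma(x)|\le C_{q,l,n,k}\,\frac{|x|^{2k-n-l}}{1+|x|^q}\qquad\text{for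 all }x\in\mathbb R^n\setminus\{0\}.$$ Here functions are real-valued, and $\nabla^l\Gamma(x)$ is the $l$-th derivative of $\Gamma$ at $x$ as an $l$-linear form, with $|\cdot|$ its operator norm. -/

import Mathlib

open MeasureTheory Filter Topology
open scoped ContDiff

/-- The geometers' Laplacian `Δ_ξ = -div ∇ = -∑ ∂ᵢ²` on Euclidean space, the opposite of the
Laplacian of Mathlib. -/
noncomputable def posLaplacian {n : ℕ} (φ : EuclideanSpace ℝ (Fin n) → ℝ) :
    EuclideanSpace ℝ (Fin n) → ℝ :=
  fun x => -(Laplacian.laplacian φ x)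

/-- `G` is an `L¹` Green's function at the origin for the operator `Δ_ξ ^ k + 1` on `ℝⁿ`:
`φ(0) = ∫ G (Δ_ξ ^ k φ + φ) dx` for every real-valued `φ ∈ C_c^∞(ℝⁿ)`. -/
structure IsGreenFunction (n k : ℕ) (G : EuclideanSpace ℝ (Fin n) → ℝ) : Prop where
  integrable : Integrable G
  integral_eq : ∀ φ : EuclideanSpace ℝ (Fin n) → ℝ, ContDiff ℝ ∞ φ → HasCompactSupport φ →
    φ 0 = ∫ x, G x * ((posLaplacian^[k] φ) x + φ x)

/-! The Green's function is the Laplace transform in time, at parameter one, of the polyharmonic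
heat kernel: `(Δ_ξ ^ k + 1)⁻¹ = ∫₀^∞ e^{-s} exp (-s Δ_ξ ^ k) ds`. The kernel of `exp (-s Δ_ξ ^ k)`
is a rescaling of one radial Schwartz function `P`, the Fourier transform of `exp (-(2π|ξ|)^{2k})`.
Substituting `s = t^{-2k}` gives `Γ(x) = ∫₀^∞ 2k tᵐ exp (-t^{-2k}) P(t x) dt` with `m = n - 2k - 1`,
which is `dilationIntegral 1 P m k`; its real part is the function sought.

The Green identity is Fubini on both sides of the Fourier transform, since the `t`-integral of the
symbols is `(1 + (2π|ξ|)^{2k})⁻¹` (`integral_dilationIntegral_mul`). Smoothness off the origin and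
all derivative bounds follow from one majorant for the integrand,
`exists_norm_dilationIntegrand_le`: Schwartz decay of `P` gives the power of `|x|`, and the factor
`exp (-t^{-2k})`, flat at `t = 0`, gives rapid decay.

For the limit at the origin, replace `exp (-t^{-2k})` by `exp (-a t^{-2k})`. Scaling turns
`|x|^{n-2k} Γ(x)` into the value at a unit vector with `a = |x|^{2k}`, so the limit is the value at
`a = 0`, the constant of the Riesz kernel. It is computed in `dilationIntegral_zero_of_norm_eq_one`
by pairing with a Gaussian.

Uniqueness is by duality: the difference of two solutions annihilates the image of `C_c^∞`, hence by
density the image of Schwartz space, and the operator is onto Schwartz space because its inverse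
symbol has temperate growth. -/

open SchwartzMap FourierTransform Set Module

/-! ### The symbol of the polyharmonic operator and its exponential -/

section Symbol

variable {V : Type*} [NormedAddCommGroup V]

/-- The Fourier symbol `(2π|ξ|)^{2k}` of the `k`-th power of the positive Laplacian. -/
noncomputable def laplaceSymbol (V : Type*) [NormedAddCommGroup V] (k : ℕ) (ξ : V) : ℝ :=
  ((2 * Real.pi) ^ 2 * ‖ξ‖ ^ 2) ^ k

lemma laplaceSymbol_nonneg (k : ℕ) (ξ : V) : 0 ≤ laplaceSymbol V k ξ := by
  unfold laplaceSymbol; positivity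

lemma laplaceSymbol_pos {k : ℕ} {ξ : V} (hξ : ξ ≠ 0) : 0 < laplaceSymbol V k ξ := by
  have : 0 < ‖ξ‖ := norm_pos_iff.2 hξ
  unfold laplaceSymbol
  positivity

/-- A polynomial in the norm is dominated by the exponential of the symbol. -/
lemma exists_pow_mul_exp_neg_laplaceSymbol_le {k : ℕ} (hk : k ≠ 0) (N : ℕ) :
    ∃ C : ℝ, ∀ ξ : V, (1 + ‖ξ‖) ^ N * Real.exp (-laplaceSymbol V k ξ) ≤ C := by
  refine ⟨2 ^ N + 2 ^ N * N.factorial, fun ξ => ?_⟩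
  have h0 := laplaceSymbol_nonneg k ξ
  have he : Real.exp (-laplaceSymbol V k ξ) ≤ 1 := Real.exp_le_one_iff.2 (by linarith)
  rcases le_total ‖ξ‖ 1 with h | h
  · have : (1 + ‖ξ‖) ^ N ≤ 2 ^ N := by gcongr; linarith
    calc (1 + ‖ξ‖) ^ N * Real.exp (-laplaceSymbol V k ξ) ≤ 2 ^ N * 1 := by gcongr
      _ ≤ _ := by rw [mul_one]; exact le_add_of_nonneg_right (by positivity)
  · have h1 : ‖ξ‖ ≤ laplaceSymbol V k ξ := by
      unfold laplaceSymbol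
      have hp : 1 ≤ (2 * Real.pi) ^ 2 := one_le_pow₀ (by nlinarith [Real.pi_gt_three])
      have h2 : ‖ξ‖ ≤ (2 * Real.pi) ^ 2 * ‖ξ‖ ^ 2 := by
        nlinarith [norm_nonneg ξ, mul_nonneg (norm_nonneg ξ) (norm_nonneg ξ)]
      exact h2.trans (le_self_pow₀ (h.trans h2) hk)
    have h2 := Real.pow_div_factorial_le_exp _ h0 N
    rw [div_le_iff₀ (by positivity)] at h2
    have h3 : (1 + ‖ξ‖) ^ N ≤ 2 ^ N * laplaceSymbol V k ξ ^ N := by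
      rw [← mul_pow]; gcongr; linarith
    calc (1 + ‖ξ‖) ^ N * Real.exp (-laplaceSymbol V k ξ)
        ≤ (2 ^ N * (Real.exp (laplaceSymbol V k ξ) * N.factorial)) *
          Real.exp (-laplaceSymbol V k ξ) := by
          gcongr; exact h3.trans (by gcongr)
      _ = 2 ^ N * N.factorial := by
          rw [Real.exp_neg]; field_simp
      _ ≤ _ := le_add_of_nonneg_left (by positivity)

variable [InnerProductSpace ℝ V]

lemma laplaceSymbol_smul (k : ℕ) (a : ℝ) (ξ : V) :
    laplaceSymbol V k (a • ξ) = a ^ (2 * k) * laplaceSymbol V k ξ := by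
  unfold laplaceSymbol
  rw [norm_smul, mul_pow ‖a‖, Real.norm_eq_abs, sq_abs, pow_mul, ← mul_pow]
  ring_nf

lemma hasTemperateGrowth_laplaceSymbol (k : ℕ) :
    Function.HasTemperateGrowth (laplaceSymbol V k) := by
  have h : Function.HasTemperateGrowth (fun ξ : V => (2 * Real.pi) ^ 2 * ‖ξ‖ ^ 2) :=
    (Function.HasTemperateGrowth.const _).mul (Function.hasTemperateGrowth_norm_sq V)
  exact h.pow k

lemma hasTemperateGrowth_one_add_laplaceSymbol (k : ℕ) :
    Function.HasTemperateGrowth (fun ξ : V => 1 + laplaceSymbol V k ξ) :=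
  (Function.HasTemperateGrowth.const (1 : ℝ)).add (hasTemperateGrowth_laplaceSymbol k)

lemma norm_iteratedDeriv_inv_le (n : ℕ) {x : ℝ} (hx : 1 / 2 < x) :
    ‖iteratedDeriv n (fun y : ℝ => y⁻¹) x‖ ≤ n.factorial * 2 ^ (n + 1) := by
  have hx0 : 0 < x := by linarith
  rw [iteratedDeriv_eq_iterate, iter_deriv_inv]
  have : (x ^ (-1 - n : ℤ)) = (x⁻¹) ^ (n + 1) := by
    rw [show (-1 - n : ℤ) = -((n + 1 : ℕ) : ℤ) by push_cast; ring, zpow_neg, zpow_natCast, inv_pow]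
  rw [this, norm_mul, norm_mul, norm_pow, norm_neg, norm_one, one_pow, one_mul, norm_pow,
    norm_inv, Real.norm_of_nonneg hx0.le]
  simp only [RCLike.norm_natCast]
  gcongr
  rw [inv_le_comm₀ hx0 (by norm_num)]
  linarith

/-- The symbol takes values in `[1, ∞)`, and `y⁻¹` has bounded derivatives of every order on the
open neighbourhood `(1/2, ∞)`. This makes the inverse operator act on Schwartz space. -/
lemma hasTemperateGrowth_inv_one_add_laplaceSymbol (k : ℕ) :
    Function.HasTemperateGrowth (fun ξ : V => (1 + laplaceSymbol V k ξ)⁻¹) := by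
  have hr : Set.range (fun ξ : V => 1 + laplaceSymbol V k ξ) ⊆ Set.Ioi (1 / 2 : ℝ) := by
    rintro - ⟨ξ, rfl⟩
    have := laplaceSymbol_nonneg k ξ
    simp only [Set.mem_Ioi]
    linarith
  have hd : ContDiffOn ℝ ∞ (fun y : ℝ => y⁻¹) (Set.Ioi (1 / 2 : ℝ)) :=
    contDiffOn_id.inv fun x hx => by
      have : (1 / 2 : ℝ) < x := hx
      simp only [id]
      linarith
  refine Function.HasTemperateGrowth.comp' hr isOpen_Ioi.uniqueDiffOn hd (fun N => ?_)
    (hasTemperateGrowth_one_add_laplaceSymbol k)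
  refine ⟨0, N.factorial * 2 ^ (N + 1), by positivity, fun m hm x hx => ?_⟩
  rw [norm_iteratedFDerivWithin_eq_norm_iteratedDerivWithin,
    iteratedDerivWithin_eq_iteratedDeriv isOpen_Ioi.uniqueDiffOn
      ((hd.contDiffAt (isOpen_Ioi.mem_nhds hx)).of_le (mod_cast le_top)) hx]
  refine (norm_iteratedDeriv_inv_le m hx).trans ?_
  rw [pow_zero, mul_one]
  have := Nat.factorial_le hm
  gcongr
  norm_num

lemma norm_iteratedFDeriv_exp_neg (n : ℕ) (x : ℝ) :
    ‖iteratedFDeriv ℝ n (fun y : ℝ => Real.exp (-y)) x‖ = Real.exp (-x) := by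
  rw [norm_iteratedFDeriv_eq_norm_iteratedDeriv]
  have := iteratedDeriv_comp_neg n Real.exp x
  rw [this, iteratedDeriv_eq_iterate, Real.iter_deriv_exp]
  simp

/-- The Schwartz function `ξ ↦ exp (-(2π|ξ|)^{2k})`. -/
noncomputable def polyharmonicGaussian (V : Type*) [NormedAddCommGroup V] [InnerProductSpace ℝ V]
    {k : ℕ} (hk : k ≠ 0) : 𝓢(V, ℝ) where
  toFun ξ := Real.exp (-laplaceSymbol V k ξ)
  smooth' := Real.contDiff_exp.comp (hasTemperateGrowth_laplaceSymbol k).1.neg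
  decay' := by
    intro a l
    obtain ⟨m, C, hC, hb⟩ :=
      (hasTemperateGrowth_laplaceSymbol (V := V) k).norm_iteratedFDeriv_le_uniform l
    -- The exponent collects `a` from the Schwartz weight and `m * l` from the chain rule, where
    -- derivatives of the symbol contribute at most the `l`-th power of `(1 + C) * (1 + ‖x‖) ^ m`.
    obtain ⟨B, hB⟩ := exists_pow_mul_exp_neg_laplaceSymbol_le (V := V) hk (a + m * l)
    refine ⟨l.factorial * (1 + C) ^ l * B, fun x => ?_⟩
    have h1 : ‖iteratedFDeriv ℝ l (fun ξ : V => Real.exp (-laplaceSymbol V k ξ)) x‖ ≤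
        l.factorial * Real.exp (-laplaceSymbol V k x) * ((1 + C) * (1 + ‖x‖) ^ m) ^ l := by
      refine norm_iteratedFDeriv_comp_le (g := fun y : ℝ => Real.exp (-y))
        (f := laplaceSymbol V k) (N := ∞) (Real.contDiff_exp.comp contDiff_neg)
        (hasTemperateGrowth_laplaceSymbol k).1 (mod_cast le_top) x
        (fun i _ => (norm_iteratedFDeriv_exp_neg i _).le) (fun i hi hil => (hb i hil x).trans ?_)
      have h2 : 1 ≤ (1 + ‖x‖) ^ m := one_le_pow₀ (by simp)
      refine le_trans ?_ (le_self_pow₀ (by nlinarith) (by omega))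
      gcongr
      linarith
    calc ‖x‖ ^ a * ‖iteratedFDeriv ℝ l (fun ξ : V => Real.exp (-laplaceSymbol V k ξ)) x‖
        ≤ (1 + ‖x‖) ^ a * (l.factorial * Real.exp (-laplaceSymbol V k x) *
          ((1 + C) * (1 + ‖x‖) ^ m) ^ l) := by
          gcongr; linarith
      _ = l.factorial * (1 + C) ^ l * ((1 + ‖x‖) ^ (a + m * l) *
          Real.exp (-laplaceSymbol V k x)) := by
          rw [mul_pow, pow_add, pow_mul]; ring
      _ ≤ _ := by gcongr; exact hB x

end Symbol

/-! ### The operator on Schwartz space as a Fourier multiplier -/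

section Operator

variable {n : ℕ}

local notation "𝔼" => EuclideanSpace ℝ (Fin n)

/-- The operator `Δ_ξ ^ k + 1` on Schwartz space as a Fourier multiplier. -/
noncomputable def greenOperator (n k : ℕ) :
    𝓢(EuclideanSpace ℝ (Fin n), ℂ) →L[ℝ] 𝓢(EuclideanSpace ℝ (Fin n), ℂ) :=
  fourierMultiplierCLM ℂ (fun ξ => 1 + laplaceSymbol (EuclideanSpace ℝ (Fin n)) k ξ)

lemma laplaceSymbol_one_multiplier_apply (f : 𝓢(𝔼, ℂ)) (x : 𝔼) :
    fourierMultiplierCLM ℂ (laplaceSymbol 𝔼 1) f x = -Laplacian.laplacian (f : 𝔼 → ℂ) x := by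
  have h1 : laplaceSymbol 𝔼 1 = ((2 * Real.pi) ^ 2) • (fun ξ : 𝔼 => ‖ξ‖ ^ 2) := by
    ext ξ; simp [laplaceSymbol]
  rw [h1, fourierMultiplierCLM_smul (Function.hasTemperateGrowth_norm_sq _),
    ← SchwartzMap.laplacian_apply, laplacian_eq_fourierMultiplierCLM]
  simp

/-- The multiplier lives on complex Schwartz functions while `posLaplacian` acts on real ones. A
real-linear `L` commutes with the Laplacian, and taking it to be the real or the imaginary part
covers both uses. -/
lemma clm_laplaceSymbol_multiplier_apply (L : ℂ →L[ℝ] ℝ) (k : ℕ) (f : 𝓢(𝔼, ℂ)) :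
    (fun x => L (fourierMultiplierCLM ℂ (laplaceSymbol 𝔼 k) f x)) =
      posLaplacian^[k] (fun x => L (f x)) := by
  induction k generalizing f with
  | zero =>
    have : laplaceSymbol 𝔼 0 = fun _ => (1 : ℝ) := by ext ξ; simp [laplaceSymbol]
    rw [this]
    simp
  | succ k ih =>
    have h1 : laplaceSymbol 𝔼 (k + 1) = laplaceSymbol 𝔼 k * laplaceSymbol 𝔼 1 := by
      ext ξ; simp [laplaceSymbol, pow_succ]
    rw [h1, ← fourierMultiplierCLM_fourierMultiplierCLM_apply (hasTemperateGrowth_laplaceSymbol k)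
      (hasTemperateGrowth_laplaceSymbol 1), ih, Function.iterate_succ_apply]
    congr 1
    ext x
    have h2 : ContDiffAt ℝ 2 f x := f.contDiffAt 2
    have h3 := h2.laplacian_CLM_comp_left (l := L)
    rw [laplaceSymbol_one_multiplier_apply, map_neg, posLaplacian]
    congr 1
    exact h3.symm

lemma clm_greenOperator_apply (L : ℂ →L[ℝ] ℝ) (k : ℕ) (f : 𝓢(𝔼, ℂ)) (x : 𝔼) :
    L (greenOperator n k f x) = posLaplacian^[k] (fun x => L (f x)) x + L (f x) := by
  have h : greenOperator n k f = f + fourierMultiplierCLM ℂ (laplaceSymbol 𝔼 k) f := by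
    simp only [greenOperator, fourierMultiplierCLM_apply]
    rw [show (fun ξ => 1 + laplaceSymbol 𝔼 k ξ) = (fun _ => (1 : ℝ)) + laplaceSymbol 𝔼 k from rfl,
      smulLeftCLM_add (Function.HasTemperateGrowth.const _) (hasTemperateGrowth_laplaceSymbol k)]
    simp [FourierTransform.fourierInv_add]
  rw [h, ← congrFun (clm_laplaceSymbol_multiplier_apply L k f) x, add_comm]
  simp

lemma re_greenOperator_apply (k : ℕ) (f : 𝓢(𝔼, ℂ)) (x : 𝔼) :
    (greenOperator n k f x).re = posLaplacian^[k] (fun x => (f x).re) x + (f x).re :=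
  clm_greenOperator_apply Complex.reCLM k f x

lemma posLaplacian_iterate_zero (k : ℕ) :
    posLaplacian^[k] (fun _ : 𝔼 => (0 : ℝ)) = fun _ => 0 := by
  refine Function.iterate_fixed ?_ k
  ext x
  simp [posLaplacian]

lemma greenOperator_apply_of_real (k : ℕ) (f : 𝓢(𝔼, ℂ)) (φ : 𝔼 → ℝ) (hf : ∀ x, f x = φ x)
    (x : 𝔼) : greenOperator n k f x = ((posLaplacian^[k] φ x + φ x : ℝ) : ℂ) := by
  apply Complex.ext
  · rw [re_greenOperator_apply]
    simp [hf]
  · have h := clm_greenOperator_apply Complex.imCLM k f x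
    simp only [Complex.imCLM_apply, hf, Complex.ofReal_im] at h
    rw [h, posLaplacian_iterate_zero]
    simp

lemma fourier_greenOperator (k : ℕ) (f : 𝓢(𝔼, ℂ)) (ξ : 𝔼) :
    𝓕 (greenOperator n k f) ξ = (1 + laplaceSymbol 𝔼 k ξ) • 𝓕 f ξ := by
  rw [greenOperator, fourierMultiplierCLM_apply, FourierTransform.fourier_fourierInv_eq,
    smulLeftCLM_apply_apply (hasTemperateGrowth_one_add_laplaceSymbol k)]

lemma greenOperator_surjective (k : ℕ) : Function.Surjective (greenOperator n k) := by
  intro f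
  refine ⟨fourierMultiplierCLM ℂ (fun ξ => (1 + laplaceSymbol 𝔼 k ξ)⁻¹) f, ?_⟩
  rw [greenOperator, fourierMultiplierCLM_fourierMultiplierCLM_apply
    (hasTemperateGrowth_one_add_laplaceSymbol k)
    (hasTemperateGrowth_inv_one_add_laplaceSymbol k)]
  have : ((fun ξ => 1 + laplaceSymbol 𝔼 k ξ) * fun ξ => (1 + laplaceSymbol 𝔼 k ξ)⁻¹) =
      fun _ => (1 : ℝ) := by
    ext ξ
    have := laplaceSymbol_nonneg k ξ
    simp only [Pi.mul_apply]
    field_simp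
  rw [this]
  simp

end Operator

/-! ### Density of compactly supported functions in Schwartz space -/

section Density

variable {V : Type*} [NormedAddCommGroup V] [InnerProductSpace ℝ V] [FiniteDimensional ℝ V]
  {F : Type*} [NormedAddCommGroup F] [NormedSpace ℝ F]

/-- A smooth compactly supported function equal to one on the unit ball, minus one. -/
noncomputable def cutoffDefect (V : Type*) [NormedAddCommGroup V] [InnerProductSpace ℝ V]
    [FiniteDimensional ℝ V] (x : V) : ℝ :=
  (⟨1, 2, one_pos, one_lt_two⟩ : ContDiffBump (0 : V)) x - 1

lemma contDiff_cutoffDefect : ContDiff ℝ ∞ (cutoffDefect V) :=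
  (ContDiffBump.contDiff _).sub contDiff_const

lemma hasCompactSupport_cutoffDefect_add_one :
    HasCompactSupport (fun x : V => cutoffDefect V x + 1) := by
  simpa [cutoffDefect] using
    (⟨1, 2, one_pos, one_lt_two⟩ : ContDiffBump (0 : V)).hasCompactSupport

lemma cutoffDefect_eventuallyEq_zero {x : V} (hx : ‖x‖ < 1) : cutoffDefect V =ᶠ[𝓝 x] 0 := by
  filter_upwards [ContDiffBump.eventuallyEq_one_of_mem_ball
    (⟨1, 2, one_pos, one_lt_two⟩ : ContDiffBump (0 : V)) (x := x) (by simpa using hx)] with y hy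
  simp [cutoffDefect, hy]

/-- The defect vanishes near every point of the open unit ball and has bounded derivatives
elsewhere. The factor `‖x‖` becomes a small factor `c` after rescaling. -/
lemma exists_norm_iteratedFDeriv_cutoffDefect_le (i : ℕ) :
    ∃ B : ℝ, 0 ≤ B ∧ ∀ x : V, ‖iteratedFDeriv ℝ i (cutoffDefect V) x‖ ≤ B * ‖x‖ := by
  have hs : ContDiff ℝ ∞ (fun x : V => cutoffDefect V x + 1) :=
    contDiff_cutoffDefect.add contDiff_const
  obtain ⟨C, hC0, hC⟩ := (hasCompactSupport_cutoffDefect_add_one.toSchwartzMap hs).decay 0 i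
  refine ⟨C + 1, by positivity, fun x => ?_⟩
  rcases lt_or_ge ‖x‖ 1 with h | h
  · rw [(EventuallyEq.iteratedFDeriv ℝ (cutoffDefect_eventuallyEq_zero h) i).eq_of_nhds]
    have : iteratedFDeriv ℝ i (0 : V → ℝ) x = 0 := by simp
    rw [this, norm_zero]
    positivity
  · have h1 : iteratedFDeriv ℝ i (cutoffDefect V) x =
        iteratedFDeriv ℝ i (fun x : V => cutoffDefect V x + 1) x -
          iteratedFDeriv ℝ i (fun _ : V => (1 : ℝ)) x := by
      rw [← iteratedFDeriv_sub_apply (hs.contDiffAt.of_le (mod_cast le_top)) contDiffAt_const]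
      congr 1
      ext y
      simp
    have h2 : ‖iteratedFDeriv ℝ i (fun _ : V => (1 : ℝ)) x‖ ≤ 1 := by
      rcases Nat.eq_zero_or_pos i with rfl | hi
      · simp
      · rw [iteratedFDeriv_const_of_ne hi.ne']
        simp
    have h3 := hC x
    simp only [pow_zero, one_mul] at h3
    calc _ ≤ C + 1 := by rw [h1]; exact (norm_sub_le _ _).trans (add_le_add h3 h2)
      _ ≤ _ := le_mul_of_one_le_right (by positivity) h

lemma hasTemperateGrowth_cutoffDefect_smul_add_one {c : ℝ} (hc : c ≠ 0) :
    Function.HasTemperateGrowth (fun x : V => cutoffDefect V (c • x) + 1) :=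
  (hasCompactSupport_cutoffDefect_add_one.comp_smul hc).hasTemperateGrowth
    ((contDiff_cutoffDefect.comp (contDiff_const_smul c)).add contDiff_const)

/-- By the Leibniz rule each term carries `c * ‖x‖` from the rescaled defect; the extra `‖x‖` is
absorbed by a seminorm with one more power of decay. -/
lemma exists_seminorm_cutoff_sub_le (f : 𝓢(V, F)) (a l : ℕ) :
    ∃ K : ℝ, 0 ≤ K ∧ ∀ c : ℝ, 0 < c → c ≤ 1 → SchwartzMap.seminorm ℝ a l
      (smulLeftCLM F (fun x : V => cutoffDefect V (c • x) + 1) f - f) ≤ c * K := by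
  choose B hB0 hB using exists_norm_iteratedFDeriv_cutoffDefect_le (V := V)
  have hK0 : 0 ≤ ∑ i ∈ Finset.range (l + 1),
      (l.choose i : ℝ) * B i * SchwartzMap.seminorm ℝ (a + 1) (l - i) f :=
    Finset.sum_nonneg fun i _ => mul_nonneg (mul_nonneg (by positivity) (hB0 i)) (apply_nonneg _ _)
  refine ⟨_, hK0, fun c hc hc1 => ?_⟩
  refine SchwartzMap.seminorm_le_bound ℝ a l _ (mul_nonneg hc.le hK0) fun x => ?_
  have h1 : (⇑(smulLeftCLM F (fun x : V => cutoffDefect V (c • x) + 1) f - f)) =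
      fun x => cutoffDefect V (c • x) • f x := by
    ext y
    simp [smulLeftCLM_apply_apply (hasTemperateGrowth_cutoffDefect_smul_add_one hc.ne'), add_smul]
  have h2 : ContDiff ℝ ∞ (fun x : V => cutoffDefect V (c • x)) :=
    contDiff_cutoffDefect.comp (contDiff_const_smul c)
  rw [h1]
  calc ‖x‖ ^ a * ‖iteratedFDeriv ℝ l (fun x => cutoffDefect V (c • x) • f x) x‖
      ≤ ‖x‖ ^ a * ∑ i ∈ Finset.range (l + 1), (l.choose i : ℝ) *
        ‖iteratedFDeriv ℝ i (fun x : V => cutoffDefect V (c • x)) x‖ *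
          ‖iteratedFDeriv ℝ (l - i) f x‖ := by
        gcongr
        exact norm_iteratedFDeriv_smul_le h2 (f.smooth ⊤) x (mod_cast le_top)
    _ ≤ c * ∑ i ∈ Finset.range (l + 1),
        (l.choose i : ℝ) * B i * SchwartzMap.seminorm ℝ (a + 1) (l - i) f := by
        rw [Finset.mul_sum, Finset.mul_sum]
        refine Finset.sum_le_sum fun i _ => ?_
        have h3 : ‖iteratedFDeriv ℝ i (fun x : V => cutoffDefect V (c • x)) x‖ ≤
            B i * (c * ‖x‖) := by
          rw [iteratedFDeriv_comp_const_smul c (contDiff_cutoffDefect.of_le (mod_cast le_top)),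
            norm_smul, norm_pow, Real.norm_of_nonneg hc.le]
          have := hB i (c • x)
          rw [norm_smul, Real.norm_of_nonneg hc.le] at this
          calc _ ≤ 1 * ‖iteratedFDeriv ℝ i (cutoffDefect V) (c • x)‖ := by
                gcongr; exact pow_le_one₀ hc.le hc1
            _ ≤ _ := by rwa [one_mul]
        have h4 := SchwartzMap.le_seminorm ℝ (a + 1) (l - i) f x
        calc _ ≤ ‖x‖ ^ a * ((l.choose i : ℝ) * (B i * (c * ‖x‖)) *
              ‖iteratedFDeriv ℝ (l - i) f x‖) := by gcongr
          _ = c * ((l.choose i : ℝ) * B i *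
              (‖x‖ ^ (a + 1) * ‖iteratedFDeriv ℝ (l - i) f x‖)) := by ring
          _ ≤ _ := by
            have := hB0 i
            gcongr

/-- Compactly supported functions are sequentially dense in Schwartz space. -/
lemma exists_hasCompactSupport_tendsto (f : 𝓢(V, F)) :
    ∃ u : ℕ → 𝓢(V, F), (∀ j, HasCompactSupport (u j)) ∧ Tendsto u atTop (𝓝 f) := by
  have hc : ∀ j : ℕ, (0 : ℝ) < 1 / ((j : ℝ) + 1) := fun j => by positivity
  refine ⟨fun j => smulLeftCLM F
    (fun x : V => cutoffDefect V ((1 / ((j : ℝ) + 1)) • x) + 1) f, fun j => ?_, ?_⟩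
  · rw [smulLeftCLM_apply (hasTemperateGrowth_cutoffDefect_smul_add_one (hc j).ne')]
    exact (hasCompactSupport_cutoffDefect_add_one.comp_smul (hc j).ne').smul_right
  · rw [(schwartz_withSeminorms ℝ V F).tendsto_nhds]
    rintro ⟨a, l⟩ ε hε
    obtain ⟨K, -, hK⟩ := exists_seminorm_cutoff_sub_le f a l
    have h1 : Tendsto (fun j : ℕ => 1 / ((j : ℝ) + 1) * K) atTop (𝓝 (0 * K)) :=
      tendsto_one_div_add_atTop_nhds_zero_nat.mul_const K
    rw [zero_mul] at h1
    filter_upwards [h1.eventually_lt_const hε] with j hj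
    refine lt_of_le_of_lt (hK _ (hc j) ?_) hj
    rw [div_le_one (by positivity)]
    simp

end Density

/-! ### Uniqueness by duality -/

section Uniqueness

variable {n k : ℕ}

local notation "𝔼" => EuclideanSpace ℝ (Fin n)

lemma integrable_mul_re {d : 𝔼 → ℝ} (hd : Integrable d) (g : 𝓢(𝔼, ℂ)) :
    Integrable fun x => d x * (g x).re :=
  hd.mul_bdd (c := SchwartzMap.seminorm ℝ 0 0 g)
    (Complex.continuous_re.comp g.continuous).aestronglyMeasurable
    (ae_of_all _ fun x => (Complex.abs_re_le_norm _).trans (norm_le_seminorm ℝ g x))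

/-- Pairing with an `L¹` function is controlled by the sup norm, a Schwartz seminorm, and
`greenOperator` is continuous, so the vanishing passes to Schwartz limits. -/
lemma integral_mul_re_eq_zero_of_forall_hasCompactSupport {d : 𝔼 → ℝ} (hd : Integrable d)
    (h : ∀ f : 𝓢(𝔼, ℂ), HasCompactSupport f → ∫ x, d x * (greenOperator n k f x).re = 0)
    (f : 𝓢(𝔼, ℂ)) : ∫ x, d x * (greenOperator n k f x).re = 0 := by
  obtain ⟨u, hu, hlim⟩ := exists_hasCompactSupport_tendsto f
  have h1 : ∀ j, |∫ x, d x * (greenOperator n k f x).re| ≤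
      (∫ x, |d x|) * SchwartzMap.seminorm ℝ 0 0 (greenOperator n k (u j - f)) := by
    intro j
    have h2 : ∫ x, d x * (greenOperator n k f x).re =
        -∫ x, d x * (greenOperator n k (u j - f) x).re := by
      have h3 : ∀ x, d x * (greenOperator n k (u j - f) x).re =
          d x * (greenOperator n k (u j) x).re - d x * (greenOperator n k f x).re := by
        intro x
        simp [map_sub, mul_sub]
      simp_rw [h3]
      rw [integral_sub (integrable_mul_re hd _) (integrable_mul_re hd _), h _ (hu j)]
      ring
    rw [h2, abs_neg, ← integral_mul_const]
    refine (abs_integral_le_integral_abs).trans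
      (integral_mono (integrable_mul_re hd _).abs (hd.abs.mul_const _) fun x => ?_)
    simp only [abs_mul]
    gcongr
    exact (Complex.abs_re_le_norm _).trans (norm_le_seminorm ℝ _ x)
  have h2 : Tendsto (fun j => (∫ x, |d x|) *
      SchwartzMap.seminorm ℝ 0 0 (greenOperator n k (u j - f))) atTop (𝓝 0) := by
    have hcont : Continuous fun g : 𝓢(𝔼, ℂ) => (∫ x, |d x|) *
        SchwartzMap.seminorm ℝ 0 0 (greenOperator n k (g - f)) :=
      continuous_const.mul (((schwartz_withSeminorms ℝ 𝔼 ℂ).continuous_seminorm (0, 0)).comp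
        ((greenOperator n k).continuous.comp (continuous_id.sub continuous_const)))
    have := (hcont.tendsto f).comp hlim
    simpa [Function.comp_def] using this
  exact abs_nonpos_iff.1 (ge_of_tendsto' h2 h1)

/-- The `L¹` Green's function is unique up to almost everywhere equality. -/
theorem IsGreenFunction.ae_eq {G H : 𝔼 → ℝ} (hG : IsGreenFunction n k G)
    (hH : IsGreenFunction n k H) : H =ᵐ[volume] G := by
  have hd : Integrable (H - G) := hH.integrable.sub hG.integrable
  have h1 : ∀ f : 𝓢(𝔼, ℂ), HasCompactSupport f →
      ∫ x, (H - G) x * (greenOperator n k f x).re = 0 := by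
    intro f hf
    have hs : ContDiff ℝ ∞ fun x => (f x).re := Complex.reCLM.contDiff.comp (f.smooth ⊤)
    have hc : HasCompactSupport fun x => (f x).re := hf.comp_left (g := Complex.re) rfl
    have e1 := hG.integral_eq _ hs hc
    have e2 := hH.integral_eq _ hs hc
    simp_rw [← re_greenOperator_apply] at e1 e2
    simp_rw [Pi.sub_apply, sub_mul]
    rw [integral_sub (integrable_mul_re hH.integrable _)
      (integrable_mul_re hG.integrable _), ← e1, ← e2, sub_self]
  have h2 : ∀ᵐ x, (H - G) x = 0 := by
    refine ae_eq_zero_of_integral_contDiff_smul_eq_zero hd.locallyIntegrable fun g hg hgc => ?_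
    have hgs : HasCompactSupport fun x => (g x : ℂ) := hgc.comp_left (g := Complex.ofReal) rfl
    let S := hgs.toSchwartzMap (Complex.ofRealCLM.contDiff.comp hg)
    have hS : ∀ x, (S x).re = g x := fun x => rfl
    -- The preimage `f` is only known to be Schwartz, not compactly supported, which is why the
    -- density step is needed.
    obtain ⟨f, hf⟩ := greenOperator_surjective k S
    have := integral_mul_re_eq_zero_of_forall_hasCompactSupport hd h1 f
    rw [hf] at this
    simp_rw [hS] at this
    simpa only [smul_eq_mul, mul_comm] using this
  filter_upwards [h2] with x hx
  simpa [sub_eq_zero] using hx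

end Uniqueness

/-! ### The one-dimensional weight and its integral -/

section Weight

/-- The weight `2k tᵐ exp (-a t^{-2k})` of the superposition of dilates. -/
noncomputable def dilationWeight (a : ℝ) (m k : ℕ) (t : ℝ) : ℝ :=
  2 * k * t ^ m * Real.exp (-(a * (t⁻¹) ^ (2 * k)))

lemma dilationWeight_nonneg (a : ℝ) (m k : ℕ) {t : ℝ} (ht : 0 < t) :
    0 ≤ dilationWeight a m k t := by
  unfold dilationWeight; positivity

lemma continuousOn_dilationWeight (a : ℝ) (m k : ℕ) :
    ContinuousOn (dilationWeight a m k) (Ioi 0) := by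
  unfold dilationWeight
  have : ContinuousOn (fun t : ℝ => t⁻¹) (Ioi 0) :=
    continuousOn_inv₀.mono fun t ht => (ne_of_gt ht : t ≠ 0)
  fun_prop

/-- From `y ^ N / N! ≤ exp y` with `y = a t^{-2k}`: each factor `a` buys `t^{2k}` near zero. This is
the source of the rapid decay of the superposition. -/
lemma pow_mul_dilationWeight_le {a : ℝ} (ha : 0 ≤ a) (m k N : ℕ) {t : ℝ} (ht : 0 < t) :
    a ^ N * dilationWeight a m k t ≤ 2 * k * N.factorial * t ^ (m + 2 * k * N) := by
  have hy : 0 ≤ a * (t⁻¹) ^ (2 * k) := by positivity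
  have h := Real.pow_div_factorial_le_exp _ hy N
  have h1 : a ^ N * Real.exp (-(a * (t⁻¹) ^ (2 * k))) ≤ N.factorial * t ^ (2 * k * N) := by
    rw [Real.exp_neg, ← div_eq_mul_inv, div_le_iff₀ (Real.exp_pos _)]
    rw [div_le_iff₀ (by positivity), mul_pow, ← pow_mul] at h
    have h2 : (t⁻¹) ^ (2 * k * N) * t ^ (2 * k * N) = 1 := by
      rw [← mul_pow, inv_mul_cancel₀ ht.ne', one_pow]
    calc a ^ N = a ^ N * (t⁻¹) ^ (2 * k * N) * t ^ (2 * k * N) := by rw [mul_assoc, h2, mul_one]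
      _ ≤ Real.exp (a * (t⁻¹) ^ (2 * k)) * N.factorial * t ^ (2 * k * N) := by gcongr
      _ = _ := by ring
  unfold dilationWeight
  calc _ = 2 * k * t ^ m * (a ^ N * Real.exp (-(a * (t⁻¹) ^ (2 * k)))) := by ring
    _ ≤ 2 * k * t ^ m * (N.factorial * t ^ (2 * k * N)) := by gcongr
    _ = _ := by rw [pow_add]; ring

lemma hasDerivAt_exp_neg_inv_pow (k : ℕ) {c : ℝ} (hc : 0 < c) {t : ℝ} (ht : 0 < t) :
    HasDerivAt (fun t : ℝ => Real.exp (-(c * (t⁻¹) ^ (2 * k))) / c)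
      (2 * k * (t⁻¹) ^ (2 * k + 1) * Real.exp (-(c * (t⁻¹) ^ (2 * k)))) t := by
  rcases Nat.eq_zero_or_pos k with rfl | hk
  · simpa using hasDerivAt_const t (Real.exp (-c) / c)
  have h1 := ((((hasDerivAt_inv ht.ne').pow (2 * k)).const_mul c).neg.exp).div_const c
  have h3 : HasDerivAt (fun t : ℝ => Real.exp (-(c * (t⁻¹) ^ (2 * k))) / c)
    (Real.exp (-(c * (t⁻¹) ^ (2 * k))) *
      -(c * (↑(2 * k) * t⁻¹ ^ (2 * k - 1) * -(t ^ 2)⁻¹)) / c) t := h1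
  refine h3.congr_deriv ?_
  obtain ⟨j, hj⟩ : ∃ j, 2 * k = j + 1 := ⟨2 * k - 1, by omega⟩
  have h2 : (2 * k : ℝ) = j + 1 := by exact_mod_cast hj
  rw [h2, hj, Nat.add_sub_cancel, ← inv_pow]
  push_cast
  generalize t⁻¹ = s
  field_simp
  ring

lemma integrableOn_integral_inv_pow_mul_exp {k : ℕ} (hk : k ≠ 0) {c : ℝ} (hc : 0 < c) :
    IntegrableOn (fun t : ℝ => 2 * k * (t⁻¹) ^ (2 * k + 1) * Real.exp (-(c * (t⁻¹) ^ (2 * k))))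
      (Ioi 0) ∧
    ∫ t in Ioi (0 : ℝ), 2 * k * (t⁻¹) ^ (2 * k + 1) * Real.exp (-(c * (t⁻¹) ^ (2 * k))) = c⁻¹ := by
  set g : ℝ → ℝ := fun t => Real.exp (-(c * (t⁻¹) ^ (2 * k))) / c with hg
  have h2k : 2 * k ≠ 0 := by omega
  -- Since `0⁻¹ = 0`, `g 0` is `1 / c` rather than the right limit `0`; the value at the endpoint
  -- has to be corrected.
  have h0 : ContinuousWithinAt (Function.update g 0 0) (Ici 0) 0 := by
    rw [continuousWithinAt_update_same, Ici_sdiff_left]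
    have h1 : Tendsto (fun t : ℝ => c * (t⁻¹) ^ (2 * k)) (𝓝[>] 0) atTop :=
      ((tendsto_pow_atTop h2k).comp tendsto_inv_nhdsGT_zero).const_mul_atTop hc
    simpa [hg] using (Real.tendsto_exp_neg_atTop_nhds_zero.comp h1).div_const c
  have hd : ∀ t ∈ Ioi (0 : ℝ), HasDerivAt (Function.update g 0 0)
      (2 * k * (t⁻¹) ^ (2 * k + 1) * Real.exp (-(c * (t⁻¹) ^ (2 * k)))) t := by
    intro t ht
    refine (hasDerivAt_exp_neg_inv_pow k hc ht).congr_of_eventuallyEq ?_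
    filter_upwards [isOpen_Ioi.mem_nhds ht] with s hs
    exact Function.update_of_ne (ne_of_gt hs) _ _
  have hpos : ∀ t ∈ Ioi (0 : ℝ),
      0 ≤ 2 * k * (t⁻¹) ^ (2 * k + 1) * Real.exp (-(c * (t⁻¹) ^ (2 * k))) := by
    intro t ht
    have : (0 : ℝ) < t := ht
    positivity
  have hlim : Tendsto (Function.update g 0 0) atTop (𝓝 c⁻¹) := by
    have h1 : Tendsto g atTop (𝓝 c⁻¹) := by
      have h2 : Tendsto (fun t : ℝ => -(c * (t⁻¹) ^ (2 * k))) atTop (𝓝 0) := by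
        simpa [h2k] using ((tendsto_inv_atTop_zero.pow (2 * k)).const_mul c).neg
      simpa [hg] using (Real.continuous_exp.tendsto 0 |>.comp h2).div_const c
    refine h1.congr' ?_
    filter_upwards [eventually_gt_atTop 0] with s hs
    exact (Function.update_of_ne (ne_of_gt hs) _ _).symm
  refine ⟨integrableOn_Ioi_deriv_of_nonneg h0 hd hpos hlim, ?_⟩
  rw [integral_Ioi_of_hasDerivAt_of_nonneg h0 hd hpos hlim]
  simp

end Weight

/-! ### Regularity and decay of superpositions of dilates -/

section Superposition

variable {V : Type*} [NormedAddCommGroup V] [InnerProductSpace ℝ V]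
  {F : Type*} [NormedAddCommGroup F] [NormedSpace ℝ F]

/-- The integrand of the `l`-th derivative of the superposition of dilates of `P`. -/
noncomputable def dilationIntegrand (a : ℝ) (P : 𝓢(V, F)) (m k l : ℕ) (x : V) (t : ℝ) :
    ContinuousMultilinearMap ℝ (fun _ : Fin l => V) F :=
  (dilationWeight a m k t * t ^ l) • iteratedFDeriv ℝ l P (t • x)

/-- The constant is independent of `a`, of `x` outside the ball of radius `ρ`, and of `t`. The same
majorant thus serves differentiation under the integral, the pointwise bounds and the limit `a → 0`.
-/
lemma exists_norm_dilationIntegrand_le (P : 𝓢(V, F)) (m k l N : ℕ) :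
    ∃ C : ℝ, 0 ≤ C ∧ ∀ a : ℝ, 0 ≤ a → ∀ ρ : ℝ, 0 < ρ → ∀ x : V, ρ ≤ ‖x‖ → ∀ t : ℝ, 0 < t →
      a ^ N * ‖dilationIntegrand a P m k l x t‖ ≤
        C * (ρ⁻¹) ^ (m + l + 2 * k * N) * (1 + (ρ * t) ^ 2)⁻¹ := by
  set A := m + l + 2 * k * N with hA
  -- Decay of order `A` cancels the growth `t ^ A` of the weights; the two further orders give
  -- integrability in `t`.
  set B := 2 ^ (A + 2) * (Finset.Iic (A + 2, l)).sup
    (fun m => SchwartzMap.seminorm ℝ m.1 m.2) P with hB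
  have hb : ∀ y : V, (1 + ‖y‖) ^ (A + 2) * ‖iteratedFDeriv ℝ l P y‖ ≤ B := fun y =>
    one_add_le_sup_seminorm_apply (m := (A + 2, l)) le_rfl le_rfl P y
  have hB0 : 0 ≤ B := le_trans (by positivity) (hb 0)
  refine ⟨2 * k * N.factorial * B, by positivity, fun a ha ρ hρ x hx t ht => ?_⟩
  have hw := pow_mul_dilationWeight_le ha m k N ht
  have hw0 := dilationWeight_nonneg a m k ht
  have h1 : (ρ * t) ^ A * (1 + (ρ * t) ^ 2) ≤ (1 + ‖t • x‖) ^ (A + 2) := by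
    have h2 : ρ * t ≤ ‖t • x‖ := by
      rw [norm_smul, Real.norm_of_nonneg ht.le, mul_comm]
      gcongr
    have h3 : 0 ≤ ρ * t := by positivity
    rw [pow_add _ A 2]
    gcongr
    · linarith
    · nlinarith
  have h2 : (ρ * t) ^ A * (1 + (ρ * t) ^ 2) * ‖iteratedFDeriv ℝ l P (t • x)‖ ≤ B :=
    le_trans (by gcongr) (hb (t • x))
  rw [dilationIntegrand, norm_smul, Real.norm_of_nonneg (by positivity)]
  calc a ^ N * (dilationWeight a m k t * t ^ l * ‖iteratedFDeriv ℝ l P (t • x)‖)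
      = a ^ N * dilationWeight a m k t * t ^ l * ‖iteratedFDeriv ℝ l P (t • x)‖ := by ring
    _ ≤ 2 * k * N.factorial * t ^ (m + 2 * k * N) * t ^ l *
        ‖iteratedFDeriv ℝ l P (t • x)‖ := by gcongr
    _ = 2 * k * N.factorial * (ρ⁻¹) ^ A * (1 + (ρ * t) ^ 2)⁻¹ *
        ((ρ * t) ^ A * (1 + (ρ * t) ^ 2) * ‖iteratedFDeriv ℝ l P (t • x)‖) := by
        have h5 : (1 + (ρ * t) ^ 2)⁻¹ * (1 + (ρ * t) ^ 2) = 1 :=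
          inv_mul_cancel₀ (by positivity)
        have h6 : (ρ⁻¹) ^ A * (ρ * t) ^ A = t ^ (m + 2 * k * N) * t ^ l := by
          rw [← mul_pow, inv_mul_cancel_left₀ hρ.ne', hA, ← pow_add]
          ring_nf
        linear_combination (-(2 * k * N.factorial * ‖iteratedFDeriv ℝ l P (t • x)‖) : ℝ) *
          ((1 + (ρ * t) ^ 2)⁻¹ * (1 + (ρ * t) ^ 2) * h6 + t ^ (m + 2 * k * N) * t ^ l * h5)
    _ ≤ 2 * k * N.factorial * (ρ⁻¹) ^ A * (1 + (ρ * t) ^ 2)⁻¹ * B := by gcongr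
    _ = _ := by ring

lemma integrableOn_inv_one_add_mul_sq {ρ : ℝ} (hρ : 0 < ρ) :
    IntegrableOn (fun t : ℝ => (1 + (ρ * t) ^ 2)⁻¹) (Ioi 0) :=
  (integrable_inv_one_add_sq.comp_mul_left' hρ.ne').integrableOn

lemma integral_Ioi_inv_one_add_mul_sq {ρ : ℝ} (hρ : 0 < ρ) :
    ∫ t in Ioi (0 : ℝ), (1 + (ρ * t) ^ 2)⁻¹ = ρ⁻¹ * (Real.pi / 2) := by
  rw [integral_comp_mul_left_Ioi (fun y : ℝ => (1 + y ^ 2)⁻¹) 0 hρ, mul_zero,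
    integral_Ioi_inv_one_add_sq]
  simp

lemma aestronglyMeasurable_dilationIntegrand (a : ℝ) (P : 𝓢(V, F)) (m k l : ℕ) (x : V) :
    AEStronglyMeasurable (dilationIntegrand a P m k l x) (volume.restrict (Ioi 0)) := by
  refine ContinuousOn.aestronglyMeasurable ?_ measurableSet_Ioi
  have h1 : Continuous fun t : ℝ => iteratedFDeriv ℝ l P (t • x) :=
    ((P.smooth ⊤).continuous_iteratedFDeriv (m := l) (mod_cast le_top)).comp (by fun_prop)
  exact ((continuousOn_dilationWeight a m k).mul (by fun_prop)).smul h1.continuousOn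

lemma integrableOn_dilationIntegrand {a : ℝ} (ha : 0 ≤ a) (P : 𝓢(V, F)) (m k l : ℕ) {x : V} (hx : x ≠ 0) :
    IntegrableOn (dilationIntegrand a P m k l x) (Ioi 0) := by
  obtain ⟨C, hC0, hC⟩ := exists_norm_dilationIntegrand_le P m k l 0
  have hx0 : 0 < ‖x‖ := norm_pos_iff.2 hx
  refine ((integrableOn_inv_one_add_mul_sq hx0).const_mul
    (C * (‖x‖⁻¹) ^ (m + l + 2 * k * 0))).mono' (aestronglyMeasurable_dilationIntegrand a P m k l x) ?_
  filter_upwards [ae_restrict_mem measurableSet_Ioi] with t ht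
  simpa using hC a ha _ hx0 x le_rfl t ht

lemma hasFDerivAt_dilationIntegrand (a : ℝ) (P : 𝓢(V, F)) (m k l : ℕ) (x : V) (t : ℝ) :
    HasFDerivAt (fun y => dilationIntegrand a P m k l y t)
      (dilationIntegrand a P m k (l + 1) x t).curryLeft x := by
  have h1 : HasFDerivAt (iteratedFDeriv ℝ l P) (iteratedFDeriv ℝ (l + 1) P (t • x)).curryLeft
      (t • x) :=
    ((P.smooth ⊤).ftaylorSeries.fderiv l (mod_cast ENat.natCast_lt_top l) (t • x))
  have h2 : HasFDerivAt (fun y : V => t • y) (t • ContinuousLinearMap.id ℝ V) x :=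
    (hasFDerivAt_id x).const_smul t
  refine ((h1.comp x h2).const_smul (dilationWeight a m k t * t ^ l)).congr_fderiv ?_
  ext v w
  simp [dilationIntegrand, pow_succ, mul_smul]

variable [CompleteSpace F]

/-- The superposition `x ↦ ∫₀^∞ 2k tᵐ exp (-t^{-2k}) P (t x) dt` of dilates of `P`. -/
noncomputable def dilationIntegral (a : ℝ) (P : 𝓢(V, F)) (m k : ℕ) (x : V) : F :=
  ∫ t in Ioi (0 : ℝ), dilationWeight a m k t • P (t • x)

/-- Differentiation under the integral, dominated on the neighbourhood `‖y‖ > ‖x‖ / 2`, which stays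
away from the origin. -/
lemma hasFDerivAt_integral_dilationIntegrand {a : ℝ} (ha : 0 ≤ a) (P : 𝓢(V, F)) (m k l : ℕ) {x : V} (hx : x ≠ 0) :
    HasFDerivAt (fun y => ∫ t in Ioi (0 : ℝ), dilationIntegrand a P m k l y t)
      (∫ t in Ioi (0 : ℝ), dilationIntegrand a P m k (l + 1) x t).curryLeft x := by
  obtain ⟨C, hC0, hC⟩ := exists_norm_dilationIntegrand_le P m k (l + 1) 0
  have hx0 : 0 < ‖x‖ / 2 := half_pos (norm_pos_iff.2 hx)
  have hs : {y : V | ‖x‖ / 2 < ‖y‖} ∈ 𝓝 x :=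
    (isOpen_lt continuous_const continuous_norm).mem_nhds (by
      change ‖x‖ / 2 < ‖x‖
      linarith)
  have h := hasFDerivAt_integral_of_dominated_of_fderiv_le (𝕜 := ℝ)
    (μ := volume.restrict (Ioi (0 : ℝ))) (x₀ := x)
    (F := fun y t => dilationIntegrand a P m k l y t)
    (F' := fun y t => continuousMultilinearCurryLeftEquiv ℝ (fun _ : Fin (l + 1) => V) F
      (dilationIntegrand a P m k (l + 1) y t))
    (bound := fun t => C * ((‖x‖ / 2)⁻¹) ^ (m + (l + 1) + 2 * k * 0) *
      (1 + (‖x‖ / 2 * t) ^ 2)⁻¹) hs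
    (Eventually.of_forall fun y => aestronglyMeasurable_dilationIntegrand a P m k l y)
    (integrableOn_dilationIntegrand ha P m k l hx)
    ((LinearIsometryEquiv.continuous _).comp_aestronglyMeasurable
      (aestronglyMeasurable_dilationIntegrand a P m k (l + 1) x))
    (by
      filter_upwards [ae_restrict_mem measurableSet_Ioi] with t ht y hy
      rw [LinearIsometryEquiv.norm_map]
      simpa using hC a ha _ hx0 y (le_of_lt hy) t ht)
    ((integrableOn_inv_one_add_mul_sq hx0).const_mul _)
    (ae_of_all _ fun t y _ => hasFDerivAt_dilationIntegrand a P m k l y t)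
  refine h.congr_fderiv ?_
  let L : ContinuousMultilinearMap ℝ (fun _ : Fin (l + 1) => V) F →L[ℝ]
      V →L[ℝ] ContinuousMultilinearMap ℝ (fun _ : Fin l => V) F :=
    (continuousMultilinearCurryLeftEquiv ℝ
      (fun _ : Fin (l + 1) => V) F).toContinuousLinearEquiv.toContinuousLinearMap
  exact ContinuousLinearMap.integral_comp_comm (𝕜 := ℝ)
    (Fₗ := V →L[ℝ] ContinuousMultilinearMap ℝ (fun _ : Fin l => V) F) L (integrableOn_dilationIntegrand ha P m k (l + 1) hx)

lemma hasFTaylorSeriesUpToOn_dilationIntegral {a : ℝ} (ha : 0 ≤ a) (P : 𝓢(V, F)) (m k : ℕ) :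
    HasFTaylorSeriesUpToOn ∞ (dilationIntegral a P m k)
      (fun x l => ∫ t in Ioi (0 : ℝ), dilationIntegrand a P m k l x t) {0}ᶜ where
  zero_eq x hx := by
    change continuousMultilinearCurryFin0 ℝ V F _ = _
    rw [dilationIntegral]
    refine ((continuousMultilinearCurryFin0 ℝ V F).toContinuousLinearEquiv.integral_comp_comm
      _).symm.trans ?_
    congr 1
    ext t
    simp [dilationIntegrand]
  fderivWithin l _ x hx := (hasFDerivAt_integral_dilationIntegrand ha P m k l hx).hasFDerivWithinAt
  cont l _ x hx :=
    (hasFDerivAt_integral_dilationIntegrand ha P m k l hx).continuousAt.continuousWithinAt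

lemma contDiffOn_dilationIntegral {a : ℝ} (ha : 0 ≤ a) (P : 𝓢(V, F)) (m k : ℕ) :
    ContDiffOn ℝ ∞ (dilationIntegral a P m k) {0}ᶜ :=
  (hasFTaylorSeriesUpToOn_dilationIntegral ha P m k).contDiffOn

lemma iteratedFDeriv_dilationIntegral {a : ℝ} (ha : 0 ≤ a) (P : 𝓢(V, F)) (m k l : ℕ) {x : V} (hx : x ≠ 0) :
    iteratedFDeriv ℝ l (dilationIntegral a P m k) x =
      ∫ t in Ioi (0 : ℝ), dilationIntegrand a P m k l x t := by
  have ho : IsOpen ({0}ᶜ : Set V) := isOpen_compl_singleton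
  rw [← iteratedFDerivWithin_of_isOpen l ho hx]
  exact ((hasFTaylorSeriesUpToOn_dilationIntegral ha P m k).eq_iteratedFDerivWithin_of_uniqueDiffOn
    (mod_cast le_top) ho.uniqueDiffOn hx).symm

lemma exists_norm_iteratedFDeriv_dilationIntegral_le_pow {a : ℝ} (ha : 0 ≤ a) (P : 𝓢(V, F)) (m k l N : ℕ) :
    ∃ C : ℝ, 0 ≤ C ∧ ∀ x : V, x ≠ 0 → a ^ N * ‖iteratedFDeriv ℝ l (dilationIntegral a P m k) x‖ ≤
      C * (‖x‖⁻¹) ^ (m + l + 2 * k * N + 1) := by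
  obtain ⟨C, hC0, hC⟩ := exists_norm_dilationIntegrand_le P m k l N
  refine ⟨C * (Real.pi / 2), by positivity, fun x hx => ?_⟩
  have hx0 : 0 < ‖x‖ := norm_pos_iff.2 hx
  rw [iteratedFDeriv_dilationIntegral ha P m k l hx, ← Real.norm_of_nonneg (pow_nonneg ha N),
    ← norm_smul, ← integral_smul]
  refine (norm_integral_le_of_norm_le ((integrableOn_inv_one_add_mul_sq hx0).const_mul
    (C * (‖x‖⁻¹) ^ (m + l + 2 * k * N))) ?_).trans (le_of_eq ?_)
  · filter_upwards [ae_restrict_mem measurableSet_Ioi] with t ht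
    rw [norm_smul, Real.norm_of_nonneg (pow_nonneg ha N)]
    exact hC a ha _ hx0 x le_rfl t ht
  · rw [integral_const_mul, integral_Ioi_inv_one_add_mul_sq hx0]
    ring

/-- Derivative bounds for the superposition, singular at the origin and rapidly decaying. -/
lemma exists_norm_iteratedFDeriv_dilationIntegral_le (P : 𝓢(V, F)) (m : ℕ) {k : ℕ} (hk : k ≠ 0)
    (l q : ℕ) : ∃ C : ℝ, 0 < C ∧ ∀ x : V, x ≠ 0 →
      ‖iteratedFDeriv ℝ l (dilationIntegral 1 P m k) x‖ ≤
        C * ((‖x‖⁻¹) ^ (m + l + 1) / (1 + ‖x‖ ^ q)) := by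
  -- `N = 0` gives the right singularity at the origin, `N = q` the decay at infinity; adding the
  -- two yields the denominator.
  obtain ⟨C, hC0, hC⟩ := exists_norm_iteratedFDeriv_dilationIntegral_le_pow zero_le_one P m k l 0
  obtain ⟨D, hD0, hD⟩ := exists_norm_iteratedFDeriv_dilationIntegral_le_pow zero_le_one P m k l q
  refine ⟨2 * (C + D) + 1, by positivity, fun x hx => ?_⟩
  have hx0 : 0 < ‖x‖ := norm_pos_iff.2 hx
  rw [← mul_div_assoc, le_div_iff₀ (by positivity)]
  have h1 := hC x hx
  have h2 := hD x hx
  rw [mul_zero, add_zero, one_pow, one_mul] at h1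
  rw [one_pow, one_mul] at h2
  set r := ‖x‖
  set y := ‖iteratedFDeriv ℝ l (dilationIntegral 1 P m k) x‖
  have hy : 0 ≤ y := norm_nonneg _
  have hq : r ^ q ≤ 1 + r ^ (2 * k * q) := by
    rcases le_total r 1 with h | h
    · exact (pow_le_one₀ hx0.le h).trans (le_add_of_nonneg_right (by positivity))
    · refine (pow_le_pow_right₀ h ?_).trans (le_add_of_nonneg_left zero_le_one)
      exact Nat.le_mul_of_pos_left q (by omega)
  have h3 : y * r ^ (2 * k * q) ≤ D * (r⁻¹) ^ (m + l + 1) := by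
    calc y * r ^ (2 * k * q) ≤ D * (r⁻¹) ^ (m + l + 2 * k * q + 1) * r ^ (2 * k * q) := by gcongr
      _ = D * (r⁻¹) ^ (m + l + 1) * ((r⁻¹) ^ (2 * k * q) * r ^ (2 * k * q)) := by ring
      _ = _ := by rw [← mul_pow, inv_mul_cancel₀ hx0.ne', one_pow, mul_one]
  have h4 : 0 ≤ (r⁻¹) ^ (m + l + 1) := by positivity
  nlinarith [mul_le_mul_of_nonneg_left hq hy, mul_nonneg hD0 h4]

end Superposition

/-! ### Radial integrals -/

section Radial

variable {V : Type*} [NormedAddCommGroup V] [InnerProductSpace ℝ V] [FiniteDimensional ℝ V]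
  [MeasurableSpace V] [BorelSpace V]

/-- In polar coordinates the singularity is harmless because `p` is less than the dimension, and the
total decay `p + s + 1` exceeds the dimension by one. -/
lemma integrable_inv_norm_pow_div [Nontrivial V] {p s : ℕ} (hs : s ≠ 0)
    (hd : finrank ℝ V = p + s) :
    Integrable fun x : V => (‖x‖⁻¹) ^ p / (1 + ‖x‖ ^ (s + 1)) := by
  rw [integrable_fun_norm_addHaar (volume : Measure V)
    (f := fun r : ℝ => (r⁻¹) ^ p / (1 + r ^ (s + 1)))]
  obtain ⟨j, rfl⟩ := Nat.exists_eq_succ_of_ne_zero hs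
  have hm : Measurable fun y : ℝ => y ^ (finrank ℝ V - 1) • ((y⁻¹) ^ p / (1 + y ^ (j + 1 + 1))) := by
    fun_prop
  refine Integrable.mono' (integrable_inv_one_add_sq.const_mul 2).integrableOn
    hm.aestronglyMeasurable ?_
  · filter_upwards [ae_restrict_mem measurableSet_Ioi] with r hr
    have hr : (0 : ℝ) < r := hr
    have h1 : r ^ (finrank ℝ V - 1) * (r⁻¹) ^ p = r ^ j := by
      rw [hd, show p + j.succ - 1 = j + p by simp; omega, pow_add, mul_assoc, ← mul_pow,
        mul_inv_cancel₀ hr.ne', one_pow, mul_one]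
    rw [smul_eq_mul, ← mul_div_assoc, h1, Real.norm_of_nonneg (by positivity), ← div_eq_mul_inv,
      div_le_div_iff₀ (by positivity) (by positivity)]
    have h2 : r ^ j ≤ 1 + r ^ (j + 2) := by
      rcases le_total r 1 with h | h
      · exact (pow_le_one₀ hr.le h).trans (le_add_of_nonneg_right (by positivity))
      · exact (pow_le_pow_right₀ h (by omega)).trans (le_add_of_nonneg_left zero_le_one)
    have h3 : r ^ j * r ^ 2 = r ^ (j + 2) := by ring
    change r ^ j * (1 + r ^ 2) ≤ 2 * (1 + r ^ (j + 2))
    nlinarith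

lemma SchwartzMap.integrable_inv_norm_pow_mul [Nontrivial V] {F : Type*} [NormedAddCommGroup F]
    [NormedSpace ℝ F] (f : 𝓢(V, F)) {p s : ℕ} (hs : s ≠ 0) (hd : finrank ℝ V = p + s) :
    Integrable fun x : V => (‖x‖⁻¹) ^ p * ‖f x‖ := by
  have h := integrable_inv_norm_pow_div hs hd
  set C := SchwartzMap.seminorm ℝ 0 0 f + SchwartzMap.seminorm ℝ (s + 1) 0 f
  have hm : Measurable fun x : V => (‖x‖⁻¹) ^ p := by fun_prop
  refine (h.const_mul C).mono' (hm.aestronglyMeasurable.mul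
    f.continuous.norm.aestronglyMeasurable) (ae_of_all _ fun x => ?_)
  rw [Real.norm_of_nonneg (by positivity)]
  have h1 : (1 + ‖x‖ ^ (s + 1)) * ‖f x‖ ≤ C := by
    rw [add_mul, one_mul]
    exact add_le_add (norm_le_seminorm ℝ f x) (norm_pow_mul_le_seminorm ℝ f (s + 1) x)
  have h2 : ‖f x‖ ≤ C / (1 + ‖x‖ ^ (s + 1)) := by
    rw [le_div_iff₀ (by positivity)]
    linarith
  calc (‖x‖⁻¹) ^ p * ‖f x‖ ≤ (‖x‖⁻¹) ^ p * (C / (1 + ‖x‖ ^ (s + 1))) := by gcongr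
    _ = _ := by ring

/-- Polar coordinates and the Gamma integral. The volume of the ball is left unevaluated because it
cancels when two such moments are compared. -/
lemma integral_inv_norm_pow_mul_exp [Nontrivial V] {p s : ℕ} (hs : s ≠ 0)
    (hd : finrank ℝ V = p + s) {b : ℝ} (hb : 0 < b) :
    ∫ x : V, (‖x‖⁻¹) ^ p * Real.exp (-b * ‖x‖ ^ 2) =
      (finrank ℝ V * (volume : Measure V).real (Metric.ball 0 1)) *
        (b ^ (-(s : ℝ) / 2) * (1 / 2) * Real.Gamma (s / 2)) := by
  have h := integral_fun_norm_addHaar (volume : Measure V)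
    (fun r : ℝ => (r⁻¹) ^ p * Real.exp (-b * r ^ 2))
  rw [h, nsmul_eq_mul, smul_eq_mul, ← mul_assoc]
  congr 1
  have hs' : (0 : ℝ) < s := by positivity
  have h2 := integral_rpow_mul_exp_neg_mul_rpow (p := 2) (q := s - 1) two_pos (by linarith) hb
  rw [show (s : ℝ) - 1 + 1 = s by ring] at h2
  rw [← h2]
  refine setIntegral_congr_fun measurableSet_Ioi fun r hr => ?_
  have hr : (0 : ℝ) < r := hr
  have h1 : r ^ (finrank ℝ V - 1) * (r⁻¹) ^ p = r ^ (s - 1) := by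
    rw [hd, show p + s - 1 = (s - 1) + p by omega, pow_add, mul_assoc, ← mul_pow,
      mul_inv_cancel₀ hr.ne', one_pow, mul_one]
  have h3 : r ^ ((s : ℝ) - 1) = r ^ (s - 1) := by
    rw [← Real.rpow_natCast, Nat.cast_sub (by omega), Nat.cast_one]
  simp only [smul_eq_mul]
  rw [← mul_assoc, h1, h3, Real.rpow_two]

end Radial

/-! ### The polyharmonic heat kernel at time one -/

section Profile

variable (V : Type*) [NormedAddCommGroup V] [InnerProductSpace ℝ V] {k : ℕ}

/-- The complex-valued version of `polyharmonicGaussian`. -/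
noncomputable def complexPolyharmonicGaussian (hk : k ≠ 0) : 𝓢(V, ℂ) :=
  SchwartzMap.postcompCLM Complex.ofRealCLM (polyharmonicGaussian V hk)

variable {V}

lemma complexPolyharmonicGaussian_apply (hk : k ≠ 0) (ξ : V) :
    complexPolyharmonicGaussian V hk ξ = (Real.exp (-laplaceSymbol V k ξ) : ℂ) := rfl

variable (V) [FiniteDimensional ℝ V] [MeasurableSpace V] [BorelSpace V]

/-- The Fourier transform of `ξ ↦ exp (-(2π|ξ|)^{2k})`, the kernel of `exp (-Δ_ξ^k)`. -/
noncomputable def polyharmonicHeatProfile (hk : k ≠ 0) : 𝓢(V, ℂ) :=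
  𝓕 (complexPolyharmonicGaussian V hk)

variable {V}

/-- A reflection carries `x` to `y`, and the Fourier transform commutes with linear isometries. -/
lemma polyharmonicHeatProfile_eq_of_norm_eq (hk : k ≠ 0) {x y : V} (h : ‖x‖ = ‖y‖) :
    polyharmonicHeatProfile V hk x = polyharmonicHeatProfile V hk y := by
  let A : V ≃ₗᵢ[ℝ] V := Submodule.reflection (ℝ ∙ (x - y))ᗮ
  have hA : A x = y := Submodule.reflection_sub h
  have h1 := Real.fourier_comp_linearIsometry A (complexPolyharmonicGaussian V hk) x
  have h2 : (complexPolyharmonicGaussian V hk : V → ℂ) ∘ A = complexPolyharmonicGaussian V hk := by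
    ext ξ
    simp [complexPolyharmonicGaussian_apply, laplaceSymbol]
  rw [h2, hA] at h1
  exact h1

lemma polyharmonicHeatProfile_smul (hk : k ≠ 0) {t : ℝ} (ht : 0 < t) (x : V) :
    polyharmonicHeatProfile V hk (t • x) =
      ((t⁻¹) ^ finrank ℝ V : ℝ) • 𝓕 (fun ξ => complexPolyharmonicGaussian V hk (t⁻¹ • ξ)) x := by
  change 𝓕 (complexPolyharmonicGaussian V hk : V → ℂ) (t • x) = _
  rw [Real.fourier_eq, Real.fourier_eq]
  have h := Measure.integral_comp_smul (volume : Measure V)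
    (fun v => 𝐞 (-inner ℝ v (t • x)) • complexPolyharmonicGaussian V hk v) t⁻¹
  have h1 : ∀ v : V, inner ℝ (t⁻¹ • v) (t • x) = inner ℝ v x := by
    intro v
    rw [real_inner_smul_left, real_inner_smul_right, inv_mul_cancel_left₀ ht.ne']
  simp only [h1] at h
  rw [h, smul_smul, abs_of_pos (by positivity), mul_inv_cancel₀ (by positivity), one_smul]

/-- Pairing a dilate of the heat profile with a Schwartz function, on the Fourier side. -/
lemma integral_polyharmonicHeatProfile_smul_mul (hk : k ≠ 0) {t : ℝ} (ht : 0 < t) (f : 𝓢(V, ℂ)) :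
    ∫ x, polyharmonicHeatProfile V hk (t • x) * f x =
      ∫ ξ, (((t⁻¹) ^ finrank ℝ V * Real.exp (-((t⁻¹) ^ (2 * k) * laplaceSymbol V k ξ)) : ℝ) : ℂ) *
        𝓕 f ξ := by
  have hi : Integrable fun ξ => complexPolyharmonicGaussian V hk (t⁻¹ • ξ) :=
    (complexPolyharmonicGaussian V hk).integrable.comp_smul (inv_ne_zero ht.ne')
  have h := VectorFourier.integral_fourierIntegral_smul_eq_flip (μ := (volume : Measure V))
    (ν := (volume : Measure V)) (e := 𝐞) (L := innerₗ V) Real.continuous_fourierChar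
    continuous_inner hi f.integrable
  rw [flip_innerₗ] at h
  simp_rw [polyharmonicHeatProfile_smul hk ht, smul_mul_assoc]
  rw [integral_smul]
  refine (congrArg _ h).trans ?_
  rw [← integral_smul]
  congr 1
  ext ξ
  rw [complexPolyharmonicGaussian_apply, laplaceSymbol_smul]
  push_cast
  simp only [smul_eq_mul, Complex.real_smul]
  push_cast
  rw [mul_assoc]
  rfl

end Profile

/-! ### Superposed heat kernels as kernels of inverse symbols -/

section Pairing

variable {V : Type*} [NormedAddCommGroup V] [InnerProductSpace ℝ V] {m k : ℕ} {a : ℝ}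

lemma norm_dilationIntegrand_zero (P : 𝓢(V, ℂ)) (x : V) (t : ℝ) :
    ‖dilationIntegrand a P m k 0 x t‖ = ‖dilationWeight a m k t • P (t • x)‖ := by
  simp [dilationIntegrand, norm_smul]

lemma aestronglyMeasurable_dilationWeight_smul (P : 𝓢(V, ℂ)) (x : V) :
    AEStronglyMeasurable (fun t => dilationWeight a m k t • P (t • x))
      (volume.restrict (Ioi 0)) :=
  ((continuousOn_dilationWeight a m k).smul
    (P.continuous.comp (by fun_prop)).continuousOn).aestronglyMeasurable measurableSet_Ioi

lemma integrableOn_dilationWeight_smul (ha : 0 ≤ a) (P : 𝓢(V, ℂ)) {x : V} (hx : x ≠ 0) :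
    IntegrableOn (fun t => dilationWeight a m k t • P (t • x)) (Ioi 0) := by
  refine Integrable.mono (integrableOn_dilationIntegrand ha P m k 0 hx)
    (aestronglyMeasurable_dilationWeight_smul P x) ?_
  filter_upwards [ae_restrict_mem measurableSet_Ioi] with t ht
  exact (norm_dilationIntegrand_zero P x t).ge

lemma exists_integral_norm_dilationWeight_smul_le (ha : 0 ≤ a) (P : 𝓢(V, ℂ)) (m k : ℕ) :
    ∃ C : ℝ, ∀ x : V, x ≠ 0 → ∫ t in Ioi (0 : ℝ), ‖dilationWeight a m k t • P (t • x)‖ ≤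
      C * (‖x‖⁻¹) ^ (m + 1) := by
  obtain ⟨C, hC0, hC⟩ := exists_norm_dilationIntegrand_le P m k 0 0
  refine ⟨C * (Real.pi / 2), fun x hx => ?_⟩
  have hx0 : 0 < ‖x‖ := norm_pos_iff.2 hx
  calc ∫ t in Ioi (0 : ℝ), ‖dilationWeight a m k t • P (t • x)‖
      ≤ ∫ t in Ioi (0 : ℝ), C * (‖x‖⁻¹) ^ m * (1 + (‖x‖ * t) ^ 2)⁻¹ := by
        refine setIntegral_mono_on (integrableOn_dilationWeight_smul ha P hx).norm
          ((integrableOn_inv_one_add_mul_sq hx0).const_mul _) measurableSet_Ioi fun t ht => ?_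
        rw [← norm_dilationIntegrand_zero P x t]
        simpa using hC a ha _ hx0 x le_rfl t ht
    _ = _ := by
        rw [integral_const_mul, integral_Ioi_inv_one_add_mul_sq hx0]
        ring

/-- Behaviour of the superposition under positive dilations. -/
lemma dilationIntegral_smul (P : 𝓢(V, ℂ)) {c : ℝ} (hc : 0 < c) (x : V) :
    dilationIntegral a P m k (c • x) =
      ((c⁻¹) ^ (m + 1) : ℝ) • dilationIntegral (a * c ^ (2 * k)) P m k x := by
  have h := integral_comp_mul_left_Ioi
    (fun u => dilationWeight (a * c ^ (2 * k)) m k u • P (u • x)) 0 hc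
  rw [mul_zero] at h
  rw [dilationIntegral, dilationIntegral, pow_succ, mul_smul, ← h, ← integral_smul]
  refine setIntegral_congr_fun measurableSet_Ioi fun t ht => ?_
  have ht : (0 : ℝ) < t := ht
  simp only [smul_smul]
  rw [mul_comm t c]
  congr 1
  unfold dilationWeight
  have h1 : (c⁻¹) ^ m * (c * t) ^ m = t ^ m := by
    rw [← mul_pow, inv_mul_cancel_left₀ hc.ne']
  have h2 : a * c ^ (2 * k) * ((c * t)⁻¹) ^ (2 * k) = a * (t⁻¹) ^ (2 * k) := by
    rw [mul_assoc, ← mul_pow, mul_inv, mul_inv_cancel_left₀ hc.ne']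
  rw [h2, ← h1]
  ring

/-- Dominated convergence, with a majorant that does not involve the parameter. -/
lemma tendsto_dilationIntegral_parameter (P : 𝓢(V, ℂ)) {x : V} (hx : x ≠ 0) {ι : Type*}
    {l : Filter ι} [l.IsCountablyGenerated] {α : ι → ℝ} (h0 : ∀ i, 0 ≤ α i)
    (hα : Tendsto α l (𝓝 0)) :
    Tendsto (fun i => dilationIntegral (α i) P m k x) l (𝓝 (dilationIntegral 0 P m k x)) := by
  obtain ⟨C, hC0, hC⟩ := exists_norm_dilationIntegrand_le P m k 0 0
  have hx0 : 0 < ‖x‖ := norm_pos_iff.2 hx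
  refine tendsto_integral_filter_of_dominated_convergence
    (fun t => C * (‖x‖⁻¹) ^ m * (1 + (‖x‖ * t) ^ 2)⁻¹)
    (Eventually.of_forall fun i => aestronglyMeasurable_dilationWeight_smul P x)
    (Eventually.of_forall fun i => ?_) ((integrableOn_inv_one_add_mul_sq hx0).const_mul _)
    (ae_of_all _ fun t => ?_)
  · filter_upwards [ae_restrict_mem measurableSet_Ioi] with t ht
    rw [← norm_dilationIntegrand_zero P x t]
    simpa using hC _ (h0 i) _ hx0 x le_rfl t ht
  · have hc : Continuous fun b : ℝ => dilationWeight b m k t • P (t • x) := by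
      unfold dilationWeight
      fun_prop
    exact (hc.tendsto 0).comp hα

/-- This fixes the exponent `m`: with the Jacobian of the dilation it leaves `t^{-(2k+1)}`, which
makes the integrand an exact derivative in `t`. -/
lemma dilationWeight_mul_inv_pow (hd : finrank ℝ V = m + 2 * k + 1) {t : ℝ} (ht : 0 < t) (ξ : V) :
    dilationWeight a m k t * ((t⁻¹) ^ finrank ℝ V *
      Real.exp (-((t⁻¹) ^ (2 * k) * laplaceSymbol V k ξ))) =
    2 * k * (t⁻¹) ^ (2 * k + 1) *
      Real.exp (-((a + laplaceSymbol V k ξ) * (t⁻¹) ^ (2 * k))) := by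
  have h1 : t ^ m * (t⁻¹) ^ finrank ℝ V = (t⁻¹) ^ (2 * k + 1) := by
    rw [hd, add_assoc, pow_add, ← mul_assoc, ← mul_pow, mul_inv_cancel₀ ht.ne', one_pow, one_mul]
  have h2 : Real.exp (-((a + laplaceSymbol V k ξ) * (t⁻¹) ^ (2 * k))) =
      Real.exp (-(a * (t⁻¹) ^ (2 * k))) *
        Real.exp (-((t⁻¹) ^ (2 * k) * laplaceSymbol V k ξ)) := by
    rw [← Real.exp_add]
    ring_nf
  rw [h2, ← h1]
  unfold dilationWeight
  ring

variable [FiniteDimensional ℝ V] [MeasurableSpace V] [BorelSpace V]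

lemma ae_ne_zero [Nontrivial V] : ∀ᵐ x : V, x ≠ 0 :=
  compl_mem_ae_iff.2 (measure_singleton 0)

lemma integrable_dilationIntegral_one [Nontrivial V] (P : 𝓢(V, ℂ)) (hk : k ≠ 0)
    (hd : finrank ℝ V = m + 2 * k + 1) : Integrable (dilationIntegral 1 P m k) := by
  obtain ⟨C, hC0, hC⟩ := exists_norm_iteratedFDeriv_dilationIntegral_le P m hk 0 (2 * k + 1)
  have h := integrable_inv_norm_pow_div (V := V) (p := m + 1) (s := 2 * k) (by omega) (by omega)
  refine (h.const_mul C).mono' ?_ ?_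
  · have hc := (contDiffOn_dilationIntegral zero_le_one P m k).continuousOn.aestronglyMeasurable
      (μ := volume) (measurableSet_singleton (0 : V)).compl
    rwa [restrict_compl_singleton] at hc
  · filter_upwards [ae_ne_zero] with x hx
    simpa using hC x hx

/-- The inner integral of the norm is `O(‖x‖^{-(m+1)})`, integrable against a Schwartz function
because `m + 1` is less than the dimension. -/
lemma integrable_prod_dilationWeight_smul [Nontrivial V] (ha : 0 ≤ a) (P f : 𝓢(V, ℂ)) (hk : k ≠ 0)
    (hd : finrank ℝ V = m + 2 * k + 1) :
    Integrable (Function.uncurry fun (x : V) (t : ℝ) => dilationWeight a m k t • P (t • x) * f x)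
      (volume.prod (volume.restrict (Ioi 0))) := by
  have hm : AEStronglyMeasurable
      (Function.uncurry fun (x : V) (t : ℝ) => dilationWeight a m k t • P (t • x) * f x)
      (volume.prod (volume.restrict (Ioi 0))) := by
    have hw : Measurable (dilationWeight a m k) := by unfold dilationWeight; fun_prop
    have h1 : AEStronglyMeasurable (fun z : V × ℝ => dilationWeight a m k z.2)
        (volume.prod (volume.restrict (Ioi 0))) := (hw.comp measurable_snd).aestronglyMeasurable
    have h2 : Continuous fun z : V × ℝ => P (z.2 • z.1) := P.continuous.comp (by fun_prop)
    have h3 : Continuous fun z : V × ℝ => f z.1 := f.continuous.comp continuous_fst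
    exact (h1.smul h2.aestronglyMeasurable).mul h3.aestronglyMeasurable
  rw [integrable_prod_iff hm]
  constructor
  · filter_upwards [ae_ne_zero] with x hx
    have h := (integrableOn_dilationWeight_smul (m := m) (k := k) ha P hx).mul_const (f x)
    exact h
  · obtain ⟨C, hC⟩ := exists_integral_norm_dilationWeight_smul_le ha P m k
    have h := f.integrable_inv_norm_pow_mul (p := m + 1) (s := 2 * k) (by omega) (by omega)
    refine (h.const_mul C).mono' hm.norm.integral_prod_right' ?_
    filter_upwards [ae_ne_zero] with x hx
    rw [Real.norm_of_nonneg (by positivity)]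
    simp only [Function.uncurry_apply_pair, norm_mul]
    rw [integral_mul_const, ← mul_assoc]
    gcongr
    simpa using hC x hx

/-- The superposition of dilates of the heat profile is the kernel of the Fourier multiplier
`(a + (2π|ξ|)^{2k})⁻¹`. -/
lemma integral_dilationIntegral_mul [Nontrivial V] (ha : 0 ≤ a) (hk : k ≠ 0)
    (hd : finrank ℝ V = m + 2 * k + 1) (f : 𝓢(V, ℂ))
    (hf : Integrable fun ξ => (a + laplaceSymbol V k ξ)⁻¹ * ‖𝓕 f ξ‖) :
    ∫ x, dilationIntegral a (polyharmonicHeatProfile V hk) m k x * f x =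
      ∫ ξ, ((a + laplaceSymbol V k ξ)⁻¹ : ℝ) • 𝓕 f ξ := by
  set P := polyharmonicHeatProfile V hk
  let J : V → ℝ → ℝ := fun ξ t => 2 * k * (t⁻¹) ^ (2 * k + 1) *
      Real.exp (-((a + laplaceSymbol V k ξ) * (t⁻¹) ^ (2 * k)))
  have hJ0 : ∀ ξ t, 0 < t → 0 ≤ J ξ t := fun ξ t ht => by
    simp only [J]
    positivity
  -- The origin is excluded because `a + laplaceSymbol V k ξ` must be positive and `a = 0` is
  -- allowed.
  have hJ : ∀ ξ : V, ξ ≠ 0 → IntegrableOn (J ξ) (Ioi 0) ∧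
      ∫ t in Ioi (0 : ℝ), J ξ t = (a + laplaceSymbol V k ξ)⁻¹ := fun ξ hξ =>
    integrableOn_integral_inv_pow_mul_exp hk (add_pos_of_nonneg_of_pos ha (laplaceSymbol_pos hξ))
  have hs : Continuous (laplaceSymbol V k) := (hasTemperateGrowth_laplaceSymbol k).1.continuous
  have hm : AEStronglyMeasurable (Function.uncurry fun (ξ : V) (t : ℝ) => J ξ t • 𝓕 f ξ)
      (volume.prod (volume.restrict (Ioi 0))) := by
    have h1 : Measurable fun z : V × ℝ => J z.1 z.2 := by
      have : Measurable (laplaceSymbol V k) := hs.measurable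
      simp only [J]
      fun_prop
    have h2 : Continuous fun z : V × ℝ => 𝓕 f z.1 := (𝓕 f).continuous.comp continuous_fst
    exact h1.aestronglyMeasurable.smul h2.aestronglyMeasurable
  have hi : Integrable (Function.uncurry fun (ξ : V) (t : ℝ) => J ξ t • 𝓕 f ξ)
      (volume.prod (volume.restrict (Ioi 0))) := by
    rw [integrable_prod_iff hm]
    constructor
    · filter_upwards [ae_ne_zero] with ξ hξ
      have h := (hJ ξ hξ).1.smul_const (𝓕 f ξ)
      exact h
    · refine hf.congr ?_
      filter_upwards [ae_ne_zero] with ξ hξ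
      rw [← (hJ ξ hξ).2, ← integral_mul_const]
      refine setIntegral_congr_fun measurableSet_Ioi fun t ht => ?_
      simp only [Function.uncurry_apply_pair, norm_smul]
      rw [Real.norm_of_nonneg (hJ0 ξ t ht)]
  calc ∫ x, dilationIntegral a P m k x * f x
      = ∫ x, ∫ t in Ioi (0 : ℝ), dilationWeight a m k t • P (t • x) * f x := by
        congr 1
        ext x
        rw [integral_mul_const, dilationIntegral]
    _ = ∫ t in Ioi (0 : ℝ), ∫ x, dilationWeight a m k t • P (t • x) * f x :=
        integral_integral_swap (integrable_prod_dilationWeight_smul ha P f hk hd)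
    _ = ∫ t in Ioi (0 : ℝ), ∫ ξ, J ξ t • 𝓕 f ξ := by
        refine setIntegral_congr_fun measurableSet_Ioi fun t ht => ?_
        simp only [smul_mul_assoc]
        rw [integral_smul, integral_polyharmonicHeatProfile_smul_mul hk ht f, ← integral_smul]
        congr 1
        ext ξ
        rw [← Complex.real_smul, smul_smul, dilationWeight_mul_inv_pow hd ht]
    _ = ∫ ξ, ∫ t in Ioi (0 : ℝ), J ξ t • 𝓕 f ξ := (integral_integral_swap hi).symm
    _ = _ := by
        refine integral_congr_ae ?_
        filter_upwards [ae_ne_zero] with ξ hξ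
        rw [integral_smul_const, (hJ ξ hξ).2]

lemma dilationIntegral_polyharmonicHeatProfile_eq_of_norm_eq (hk : k ≠ 0) {x y : V}
    (h : ‖x‖ = ‖y‖) : dilationIntegral a (polyharmonicHeatProfile V hk) m k x =
      dilationIntegral a (polyharmonicHeatProfile V hk) m k y := by
  unfold dilationIntegral
  congr 1
  ext t
  rw [polyharmonicHeatProfile_eq_of_norm_eq hk (x := t • x) (y := t • y)]
  rw [norm_smul, norm_smul, h]

/-- Radial symmetry and scaling trade the size of `x` for the parameter, so the behaviour at the
origin becomes the limit of vanishing parameter at a fixed unit vector. -/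
lemma dilationIntegral_polyharmonicHeatProfile_eq (hk : k ≠ 0) {e : V} (he : ‖e‖ = 1) {x : V}
    (hx : x ≠ 0) : dilationIntegral a (polyharmonicHeatProfile V hk) m k x =
      ((‖x‖⁻¹) ^ (m + 1) : ℝ) •
        dilationIntegral (a * ‖x‖ ^ (2 * k)) (polyharmonicHeatProfile V hk) m k e := by
  rw [← dilationIntegral_smul _ (norm_pos_iff.2 hx)]
  refine dilationIntegral_polyharmonicHeatProfile_eq_of_norm_eq hk ?_
  rw [norm_smul, he, norm_norm, mul_one]

lemma fourier_complexPolyharmonicGaussian_one (ξ : V) :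
    𝓕 (complexPolyharmonicGaussian V one_ne_zero) ξ =
      (((4 * Real.pi) ^ (-(finrank ℝ V : ℝ) / 2) * Real.exp (-(1 / 4) * ‖ξ‖ ^ 2) : ℝ) : ℂ) := by
  have hb : 0 < ((4 * Real.pi ^ 2 : ℝ) : ℂ).re := by
    rw [Complex.ofReal_re]
    positivity
  have h := fourier_gaussian_innerProductSpace hb ξ
  have h1 : (fun v : V => Complex.exp (-((4 * Real.pi ^ 2 : ℝ) : ℂ) * ‖v‖ ^ 2)) =
      (complexPolyharmonicGaussian V one_ne_zero : V → ℂ) := by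
    ext v
    rw [complexPolyharmonicGaussian_apply, Complex.ofReal_exp, laplaceSymbol]
    congr 1
    push_cast
    ring
  rw [h1] at h
  refine Eq.trans h ?_
  have hπ := Real.pi_pos
  have h2 : (Real.pi / ((4 * Real.pi ^ 2 : ℝ) : ℂ)) = (((4 * Real.pi)⁻¹ : ℝ) : ℂ) := by
    rw [← Complex.ofReal_div]
    congr 1
    field_simp
  have h3 : (-Real.pi ^ 2 * ‖ξ‖ ^ 2 / ((4 * Real.pi ^ 2 : ℝ) : ℂ)) =
      ((-(1 / 4) * ‖ξ‖ ^ 2 : ℝ) : ℂ) := by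
    have : (Real.pi : ℂ) ≠ 0 := by exact_mod_cast hπ.ne'
    push_cast
    field_simp
  rw [h2, h3, Complex.ofReal_mul ((4 * Real.pi) ^ _), Complex.ofReal_exp]
  congr 1
  rw [show ((finrank ℝ V : ℂ) / 2) = (((finrank ℝ V : ℝ) / 2 : ℝ) : ℂ) by push_cast; rfl,
    ← Complex.ofReal_cpow (by positivity), Real.inv_rpow (by positivity), ← Real.rpow_neg
    (by positivity), neg_div]

/-- The value on the unit sphere of the homogeneous kernel with symbol `(2π|ξ|)^{-2k}`. -/
lemma dilationIntegral_zero_of_norm_eq_one [Nontrivial V] (hk : k ≠ 0)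
    (hd : finrank ℝ V = m + 2 * k + 1) {e : V} (he : ‖e‖ = 1) :
    dilationIntegral 0 (polyharmonicHeatProfile V hk) m k e =
      ((Real.Gamma ((finrank ℝ V : ℝ) / 2 - k) /
        (2 ^ (2 * k) * ((k - 1).factorial : ℝ) * Real.pi ^ ((finrank ℝ V : ℝ) / 2)) : ℝ) : ℂ) := by
  set P := polyharmonicHeatProfile V hk with hP
  set Λ := dilationIntegral 0 P m k e with hΛ
  set f := complexPolyharmonicGaussian V one_ne_zero with hf
  set d := finrank ℝ V with hd'
  set σ := (d * (volume : Measure V).real (Metric.ball 0 1)) with hσ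
  have hπ := Real.pi_pos
  have hσ0 : σ ≠ 0 := by
    have h1 : (volume : Measure V).real (Metric.ball 0 1) ≠ 0 :=
      (ENNReal.toReal_pos (Metric.measure_ball_pos _ _ one_pos).ne' measure_ball_lt_top.ne).ne'
    have h2 : (d : ℝ) ≠ 0 := by rw [hd]; positivity
    exact mul_ne_zero h2 h1
  have hsym : ∀ ξ : V, (0 + laplaceSymbol V k ξ)⁻¹ =
      ((2 * Real.pi) ^ (2 * k))⁻¹ * (‖ξ‖⁻¹) ^ (2 * k) := by
    intro ξ
    rw [laplaceSymbol, zero_add, mul_pow, ← pow_mul, ← pow_mul, mul_inv, inv_pow]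
  have hint : Integrable fun ξ => (0 + laplaceSymbol V k ξ)⁻¹ * ‖𝓕 f ξ‖ := by
    have h := (𝓕 f).integrable_inv_norm_pow_mul (p := 2 * k) (s := m + 1) (by omega) (by omega)
    refine (h.const_mul ((2 * Real.pi) ^ (2 * k))⁻¹).congr (ae_of_all _ fun ξ => ?_)
    simp only [hsym]
    ring
  -- Test with a Gaussian at `a = 0`: the kernel is `Λ * ‖x‖^{-(m+1)}`, so both sides are Gaussian
  -- moments with the common factor `σ`, and the identity can be solved for `Λ`.
  have key := integral_dilationIntegral_mul (m := m) le_rfl hk hd f hint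
  have hL : ∫ x, dilationIntegral 0 P m k x * f x =
      Λ * ((σ * ((4 * Real.pi ^ 2) ^ (-((2 * k : ℕ) : ℝ) / 2) * (1 / 2) *
        Real.Gamma ((2 * k : ℕ) / 2)) : ℝ) : ℂ) := by
    rw [← integral_inv_norm_pow_mul_exp (V := V) (p := m + 1) (s := 2 * k) (by omega) (by omega)
      (by positivity), ← integral_complex_ofReal, ← integral_const_mul]
    refine integral_congr_ae ?_
    filter_upwards [ae_ne_zero] with x hx
    rw [hP, dilationIntegral_polyharmonicHeatProfile_eq hk he hx, zero_mul, ← hP, ← hΛ, hf,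
      complexPolyharmonicGaussian_apply, Complex.real_smul]
    have : -laplaceSymbol V 1 x = -(4 * Real.pi ^ 2) * ‖x‖ ^ 2 := by
      unfold laplaceSymbol; ring
    rw [this]
    push_cast
    ring
  have hR : ∫ ξ, ((0 + laplaceSymbol V k ξ)⁻¹ : ℝ) • 𝓕 f ξ =
      ((((2 * Real.pi) ^ (2 * k))⁻¹ * (4 * Real.pi) ^ (-(d : ℝ) / 2) *
        (σ * ((1 / 4) ^ (-((m + 1 : ℕ) : ℝ) / 2) * (1 / 2) *
          Real.Gamma ((m + 1 : ℕ) / 2))) : ℝ) : ℂ) := by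
    rw [← integral_inv_norm_pow_mul_exp (V := V) (p := 2 * k) (s := m + 1) (by omega) (by omega)
      (by positivity), Complex.ofReal_mul, ← integral_complex_ofReal, ← integral_const_mul]
    congr 1
    ext ξ
    rw [hf, fourier_complexPolyharmonicGaussian_one, hsym, Complex.real_smul]
    push_cast
    ring
  rw [hL, hR] at key
  have hΓ : Real.Gamma ((2 * k : ℕ) / 2) = ((k - 1).factorial : ℝ) := by
    obtain ⟨j, rfl⟩ := Nat.exists_eq_succ_of_ne_zero hk
    rw [show (((2 * j.succ : ℕ) : ℝ) / 2) = j + 1 by push_cast; ring, Real.Gamma_nat_eq_factorial]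
    simp
  have h1 : (4 * Real.pi ^ 2) ^ (-((2 * k : ℕ) : ℝ) / 2) = ((2 * Real.pi) ^ (2 * k))⁻¹ := by
    rw [show (-((2 * k : ℕ) : ℝ) / 2) = -(k : ℝ) by push_cast; ring, Real.rpow_neg (by positivity),
      Real.rpow_natCast, show (4 * Real.pi ^ 2) = (2 * Real.pi) ^ 2 by ring, ← pow_mul]
  have hdk : ((m + 1 : ℕ) : ℝ) / 2 = (d : ℝ) / 2 - k := by
    rw [hd]
    push_cast
    ring
  have h2 : (4 * Real.pi) ^ (-(d : ℝ) / 2) * (1 / 4 : ℝ) ^ (-((m + 1 : ℕ) : ℝ) / 2) =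
      (2 ^ (2 * k) * Real.pi ^ ((d : ℝ) / 2))⁻¹ := by
    rw [neg_div, neg_div, hdk, Real.mul_rpow (by norm_num) hπ.le, one_div,
      Real.inv_rpow (by norm_num), ← Real.rpow_neg (by norm_num), neg_neg, mul_right_comm,
      ← Real.rpow_add (by norm_num), mul_inv, Real.rpow_neg hπ.le]
    congr 1
    rw [show -((d : ℝ) / 2) + ((d : ℝ) / 2 - k) = -(k : ℝ) by ring, Real.rpow_neg (by norm_num),
      Real.rpow_natCast, pow_mul]
    norm_num
  rw [h1, hΓ, hdk] at key
  have h3 : ((σ * (((2 * Real.pi) ^ (2 * k))⁻¹ * (1 / 2) * ((k - 1).factorial : ℝ)) : ℝ) : ℂ) ≠ 0 := by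
    refine Complex.ofReal_ne_zero.2 ?_
    positivity
  rw [← mul_right_inj' h3, mul_comm, key, ← Complex.ofReal_mul, Complex.ofReal_inj]
  have h4 : (0 : ℝ) < (k - 1).factorial := by positivity
  calc _ = ((2 * Real.pi) ^ (2 * k))⁻¹ * σ * (1 / 2) * Real.Gamma ((d : ℝ) / 2 - k) *
      ((4 * Real.pi) ^ (-(d : ℝ) / 2) * (1 / 4 : ℝ) ^ (-((m + 1 : ℕ) : ℝ) / 2)) := by ring
    _ = _ := by
        rw [h2]
        field_simp

end Pairing

/-! ### The Green identity and the asymptotics at the origin -/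

section Green

variable {n k m : ℕ}

local notation "𝔼" => EuclideanSpace ℝ (Fin n)

lemma integral_fourier_eq_apply_zero (f : 𝓢(𝔼, ℂ)) : ∫ ξ, 𝓕 f ξ = f 0 := by
  have h : 𝓕⁻ (𝓕 f) 0 = f 0 := by rw [FourierTransform.fourierInv_fourier_eq]
  rw [fourierInv_coe, Real.fourierInv_eq] at h
  simpa using h

/-- The inverse symbol cancels the symbol of the operator, leaving the integral of `𝓕 f`, which is
`f 0` by Fourier inversion. -/
lemma integral_dilationIntegral_mul_greenOperator [Nontrivial 𝔼] (hk : k ≠ 0)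
    (hn : n = m + 2 * k + 1) (f : 𝓢(𝔼, ℂ)) :
    ∫ x, dilationIntegral 1 (polyharmonicHeatProfile 𝔼 hk) m k x * greenOperator n k f x = f 0 := by
  have h1 : ∀ ξ, (1 + laplaceSymbol 𝔼 k ξ)⁻¹ • 𝓕 (greenOperator n k f) ξ = 𝓕 f ξ := by
    intro ξ
    have := laplaceSymbol_nonneg k ξ
    rw [fourier_greenOperator, smul_smul, inv_mul_cancel₀ (by positivity), one_smul]
  rw [integral_dilationIntegral_mul zero_le_one hk (by simpa using hn)]
  · simp_rw [h1]
    exact integral_fourier_eq_apply_zero f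
  · refine (𝓕 f).integrable.norm.congr (ae_of_all _ fun ξ => ?_)
    have := laplaceSymbol_nonneg k ξ
    simp only [← h1 ξ, norm_smul]
    rw [Real.norm_of_nonneg (by positivity)]

/-- The real part of the superposition of dilated heat profiles is a Green's function. -/
lemma isGreenFunction_re_dilationIntegral [Nontrivial 𝔼] (hk : k ≠ 0) (hn : n = m + 2 * k + 1) :
    IsGreenFunction n k
      fun x => (dilationIntegral 1 (polyharmonicHeatProfile 𝔼 hk) m k x).re where
  integrable := (integrable_dilationIntegral_one _ hk (by simpa using hn)).re
  integral_eq φ hφ hc := by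
    have hcs : HasCompactSupport fun x => (φ x : ℂ) := hc.comp_left (g := Complex.ofReal) rfl
    let f : 𝓢(𝔼, ℂ) := hcs.toSchwartzMap (Complex.ofRealCLM.contDiff.comp hφ)
    have hf : ∀ x, f x = φ x := fun x => rfl
    have h := integral_dilationIntegral_mul_greenOperator hk hn f
    have hi : Integrable fun x =>
        dilationIntegral 1 (polyharmonicHeatProfile 𝔼 hk) m k x * greenOperator n k f x :=
      (integrable_dilationIntegral_one _ hk (by simpa using hn)).mul_bdd
        (c := SchwartzMap.seminorm ℝ 0 0 (greenOperator n k f))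
        (greenOperator n k f).continuous.aestronglyMeasurable
        (ae_of_all _ fun x => norm_le_seminorm ℝ _ x)
    -- On a real test function the operator is real valued, so taking real parts acts on the kernel
    -- alone; whether the kernel is real need not be decided.
    have h2 := integral_re hi
    simp only [RCLike.re_to_complex] at h2
    rw [h, hf, Complex.ofReal_re] at h2
    rw [← h2]
    congr 1
    ext x
    rw [greenOperator_apply_of_real k f φ hf, Complex.re_mul_ofReal]

lemma tendsto_norm_pow_smul_dilationIntegral [Nontrivial 𝔼] (hk : k ≠ 0)
    (hn : n = m + 2 * k + 1) :
    Tendsto (fun x : 𝔼 => ‖x‖ ^ (m + 1) •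
        dilationIntegral 1 (polyharmonicHeatProfile 𝔼 hk) m k x) (𝓝[≠] 0)
      (𝓝 ((Real.Gamma ((n : ℝ) / 2 - k) /
        (2 ^ (2 * k) * ((k - 1).factorial : ℝ) * Real.pi ^ ((n : ℝ) / 2)) : ℝ) : ℂ)) := by
  obtain ⟨e, he⟩ := exists_norm_eq 𝔼 zero_le_one
  have he0 : e ≠ 0 := norm_ne_zero_iff.1 (by rw [he]; exact one_ne_zero)
  have h := dilationIntegral_zero_of_norm_eq_one (V := 𝔼) (m := m) hk (by simpa using hn) he
  rw [finrank_euclideanSpace_fin] at h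
  rw [← h]
  have h1 : Tendsto (fun x : 𝔼 => ‖x‖ ^ (2 * k)) (𝓝[≠] 0) (𝓝 0) := by
    have hc : Continuous fun x : 𝔼 => ‖x‖ ^ (2 * k) := by fun_prop
    have := (hc.tendsto 0).mono_left (nhdsWithin_le_nhds (s := {0}ᶜ))
    simpa [hk] using this
  refine (tendsto_dilationIntegral_parameter (m := m) (k := k) (polyharmonicHeatProfile 𝔼 hk) he0
    (fun x => by positivity) h1).congr' ?_
  filter_upwards [self_mem_nhdsWithin] with x hx
  have hx0 : ‖x‖ ≠ 0 := norm_ne_zero_iff.2 hx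
  rw [dilationIntegral_polyharmonicHeatProfile_eq hk he hx, smul_smul, ← mul_pow,
    mul_inv_cancel₀ hx0, one_pow, one_smul, one_mul]

end Green

/-! ### Assembly of the theorem -/

theorem theorem7p2 (n k : ℕ) (hk : 2 ≤ 2 * k) (hn : 2 * k < n) :
    ∃ G : EuclideanSpace ℝ (Fin n) → ℝ,
      -- existence and uniqueness in `L¹(ℝⁿ)`, whose elements are functions up to a.e. equality
      IsGreenFunction n k G ∧
      (∀ H : EuclideanSpace ℝ (Fin n) → ℝ, IsGreenFunction n k H → H =ᵐ[volume] G) ∧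
      -- smooth off the origin and radially symmetric
      ContDiffOn ℝ ∞ G {0}ᶜ ∧
      (∀ x y : EuclideanSpace ℝ (Fin n), ‖x‖ = ‖y‖ → G x = G y) ∧
      -- asymptotics at the origin
      Tendsto (fun x : EuclideanSpace ℝ (Fin n) => ‖x‖ ^ ((n : ℤ) - 2 * (k : ℤ)) * G x) (𝓝[≠] 0)
        (𝓝 (Real.Gamma ((n : ℝ) / 2 - (k : ℝ)) /
          (2 ^ (2 * k) * ((k - 1).factorial : ℝ) * Real.pi ^ ((n : ℝ) / 2)))) ∧
      -- pointwise bounds for all derivatives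
      ∀ l q : ℕ, ∃ C : ℝ, 0 < C ∧ ∀ x : EuclideanSpace ℝ (Fin n), x ≠ 0 →
        ‖iteratedFDeriv ℝ l G x‖ ≤
          C * (‖x‖ ^ (2 * (k : ℤ) - (n : ℤ) - (l : ℤ)) / (1 + ‖x‖ ^ q)) := by
  have hk0 : k ≠ 0 := by omega
  obtain ⟨m, hm⟩ : ∃ m, n = m + 2 * k + 1 := ⟨n - 2 * k - 1, by omega⟩
  have : Nontrivial (EuclideanSpace ℝ (Fin n)) :=
    Module.nontrivial_of_finrank_pos (R := ℝ) (by rw [finrank_euclideanSpace_fin]; omega)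
  set K := dilationIntegral 1 (polyharmonicHeatProfile (EuclideanSpace ℝ (Fin n)) hk0) m k with hK
  have hG := isGreenFunction_re_dilationIntegral hk0 hm
  have hsmooth : ContDiffOn ℝ ∞ K {0}ᶜ := contDiffOn_dilationIntegral zero_le_one _ m k
  refine ⟨fun x => (K x).re, hG, fun H hH => hG.ae_eq hH, Complex.reCLM.contDiff.comp_contDiffOn
    hsmooth, fun x y h => ?_, ?_, fun l q => ?_⟩
  · exact congrArg Complex.re (dilationIntegral_polyharmonicHeatProfile_eq_of_norm_eq hk0 h)
  · have h := (Complex.continuous_re.tendsto _).comp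
      (tendsto_norm_pow_smul_dilationIntegral (n := n) hk0 hm)
    rw [Complex.ofReal_re] at h
    refine h.congr fun x => ?_
    have h1 : (n : ℤ) - 2 * (k : ℤ) = ((m + 1 : ℕ) : ℤ) := by rw [hm]; push_cast; ring
    rw [h1, zpow_natCast, Function.comp_apply, Complex.smul_re, smul_eq_mul]
  · obtain ⟨C, hC0, hC⟩ := exists_norm_iteratedFDeriv_dilationIntegral_le
      (polyharmonicHeatProfile (EuclideanSpace ℝ (Fin n)) hk0) m hk0 l q
    refine ⟨C, hC0, fun x hx => ?_⟩
    have hxK : ContDiffAt ℝ ∞ K x := hsmooth.contDiffAt (isOpen_compl_singleton.mem_nhds hx)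
    have h1 : 2 * (k : ℤ) - (n : ℤ) - (l : ℤ) = -((m + l + 1 : ℕ) : ℤ) := by
      rw [hm]; push_cast; ring
    rw [h1, zpow_neg, zpow_natCast, ← inv_pow]
    refine le_trans ?_ (hC x hx)
    -- Taking real parts is a linear map of norm one, so it does not increase the norms of
    -- derivatives.
    have h2 := Complex.reCLM.norm_iteratedFDeriv_comp_left hxK (n := l) (mod_cast le_top)
    refine h2.trans ?_
    rw [Complex.reCLM_norm, one_mul]
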